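/- Let $\mathcal H$ be a complex Hilbert space (scalar product linear in the second variable) and $q\in[-1,1]$. On the tensor powers $\mathcal H^{\otimes n}$ (with $\mathcal H^{\otimes 0}=\mathbb C$) let $\lambda_0,\lambda_1$ be the identities, $\lambda_2(f\otimes g)=f\otimes g+q\,g\otimes f$ and $\lambda_{n+2}=\mathbf 1_{\mathcal H}^{\otimes n}\otimes\lambda_2$ for $n\ge 1$. Let $\mathcal H_n$ be the Hilbert space obtained from $\mathcal H^{\otimes n}$ with the semi-inner product $\langle F,G\rangle_n=\langle F,\lambda_nG\rangle_{\otimes n}$ by dividing by the kernel and completing. The $(\mathbf q,2)$-Fock space is the Hilbert sum $\Gamma_{q,2}(\mathcal H)=\bigoplus_{n\ge0}\mathcal H_n$, with vacuum vector $\Phi=1\oplus0\oplus0\oplus\cdots$. For $f\in\mathcal H$, the creation operator $A^+(f)$ is the bounded linear operator with $A^+(f)\Phi=f$ and $A^+(f)F=f\otimes F$ for $F\in\mathcal H_n$, $n\ge1$; the annihilation operator is $A(f)=A^+(f)^*$, and the field operator is $Q(f)=A(f)+A^+(f)$. The (vacuum) distribution of a bounded self-adjoint operator $X$ on $\Gamma_{q,2}(\mathcal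 H)$ is the unique compactly supported probability measure $\mu$ on $\mathbb R$ with $\int x^k\,\mu(dx)=\langle\Phi,X^k\Phi\rangle$ for all $k\in\mathbb N$. Let $a=1+q$. For $a\in(0,2]$ put $$p_a(x)=\frac{2a}{\pi}\cdot\frac{\sqrt{1-x}}{\sqrt x\,\bigl(1+4(a-1)(a+2)x-16(a-1)x^2\bigr)}\,\chi_{(0,1)}(x),\qquad x\in\mathbb R,$$ and for $a>1$ put $$a_1=\frac{\sqrt{(a+2)^2+\frac4{a-1}}+a+2}{8},\qquad a_2=\frac{\sqrt{(a+2)^2+\frac4{a-1}}-a-2}{8},$$ $$A_1=16(a-1)-\frac{2a}{a_1+a_2}\left(\sqrt{\frac{a_2+1}{a_2}}-\sqrt{\frac{a_1-1}{a_1}}\right).$$ Then for every $a\in(0,2]$ the function $p_a$ is measurable, non-negative on $\mathbb R$ and strictly positive on $(0,1)$. Moreover: 1) if $a\in(0,\frac32]$, then for every $f\in\mathcal H$ with $\|f\|=\frac12$, $p_a$ is the probability density function of the distribution of $Q(f)^2$; 2) if $a\in(\frac32,2]$, then $p_a$ is not a probability density function, i.e. $\int_{\mathbb R}p_a(x)\,dx\ne1$;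 one has $\frac{A_1}{16(a-1)}\ge 0$; and for every $f\in\mathcal H$ with $\|f\|=\frac12$ the distribution of $Q(f)^2$ is the probability measure $$B\longmapsto\int_Bp_a(x)\,dx+\frac{A_1}{16(a-1)}\,\delta_{a_1}(B),\qquad B\subseteq\mathbb R\text{ Borel}.$$ -/

import Mathlib

open scoped TensorProduct

universe u

noncomputable section

namespace QTwoFock

/-! ## Algebraic tensor powers with their standard scalar product -/

/-- A type bundled with a complex inner product (used only to carry the instances through the
recursion defining the tensor powers). -/
structure InnerSpaceBundle : Type (u + 1) where
  carrier : Type u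
  [grp : NormedAddCommGroup carrier]
  [inn : InnerProductSpace ℂ carrier]

attribute [instance] InnerSpaceBundle.grp InnerSpaceBundle.inn

section

variable (H : Type u) [NormedAddCommGroup H] [InnerProductSpace ℂ H]

/-- The recursion `H^{⊗0} = ℂ`, `H^{⊗(n+1)} = H ⊗ H^{⊗n}`. The scalars are represented by the
one-dimensional Hilbert space `EuclideanSpace ℂ PUnit` only in order to live in the universe
of `H`. -/
def tensorPowBundle : ℕ → InnerSpaceBundle.{u}
  | 0 => ⟨EuclideanSpace ℂ PUnit.{u + 1}⟩
  | n + 1 => ⟨H ⊗[ℂ] (tensorPowBundle n).carrier⟩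

/-- The algebraic tensor power `H^{⊗n}`, with scalar product
`⟪f₁ ⊗ ⋯ ⊗ fₙ, g₁ ⊗ ⋯ ⊗ gₙ⟫ = ∏ ⟪fᵢ, gᵢ⟫`. -/
def TensorPow (n : ℕ) : Type u := (tensorPowBundle H n).carrier

instance (n : ℕ) : NormedAddCommGroup (TensorPow H n) := (tensorPowBundle H n).grp

instance (n : ℕ) : InnerProductSpace ℂ (TensorPow H n) := (tensorPowBundle H n).inn

/-- The identification `H^{⊗0} = ℂ`. -/
def zeroIso : TensorPow H 0 ≃ₗᵢ[ℂ] EuclideanSpace ℂ PUnit.{u + 1} :=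
  LinearIsometryEquiv.refl ℂ (EuclideanSpace ℂ PUnit.{u + 1})

/-- The identification `H^{⊗(n+1)} = H ⊗ H^{⊗n}`. -/
def succIso (n : ℕ) : TensorPow H (n + 1) ≃ₗᵢ[ℂ] H ⊗[ℂ] TensorPow H n :=
  LinearIsometryEquiv.refl ℂ (H ⊗[ℂ] TensorPow H n)

/-- The unit `1 ∈ ℂ = H^{⊗0}`. -/
def unitVec : TensorPow H 0 := (zeroIso H).symm (EuclideanSpace.single PUnit.unit 1)

end

section

variable {H : Type u} [NormedAddCommGroup H] [InnerProductSpace ℂ H]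

/-- `F ↦ f ⊗ F` from `H^{⊗n}` to `H^{⊗(n+1)}`. -/
def tmulLeft (f : H) (n : ℕ) : TensorPow H n →ₗ[ℂ] TensorPow H (n + 1) :=
  (succIso H n).symm.toLinearEquiv.toLinearMap ∘ₗ TensorProduct.mk ℂ H (TensorPow H n) f

/-- `id_H ⊗ T`, acting on `H^{⊗(n+1)} = H ⊗ H^{⊗n}`. -/
def idTensor {n : ℕ} (T : TensorPow H n →ₗ[ℂ] TensorPow H n) :
    TensorPow H (n + 1) →ₗ[ℂ] TensorPow H (n + 1) :=
  (succIso H n).symm.toLinearEquiv.toLinearMap ∘ₗ T.lTensor H ∘ₗ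
    (succIso H n).toLinearEquiv.toLinearMap

variable (H) in
/-- The flip `f ⊗ g ↦ g ⊗ f` on `H^{⊗2}`. -/
def flipTwo : TensorPow H 2 →ₗ[ℂ] TensorPow H 2 :=
  (succIso H 1).symm.toLinearEquiv.toLinearMap ∘ₗ
    ((succIso H 0).symm.toLinearEquiv.toLinearMap.lTensor H) ∘ₗ
    (TensorProduct.leftComm ℂ H H (TensorPow H 0)).toLinearMap ∘ₗ
    ((succIso H 0).toLinearEquiv.toLinearMap.lTensor H) ∘ₗ
    (succIso H 1).toLinearEquiv.toLinearMap

/-- The operators `λₙ` on `H^{⊗n}`: `λ₀` and `λ₁` are identities,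
`λ₂ (f ⊗ g) = f ⊗ g + q g ⊗ f`, and `λₙ₊₂ = 1_H^{⊗n} ⊗ λ₂`, that is `λₙ₊₃ = 1_H ⊗ λₙ₊₂`. -/
def lam (q : ℝ) : (n : ℕ) → TensorPow H n →ₗ[ℂ] TensorPow H n
  | 0 => LinearMap.id
  | 1 => LinearMap.id
  | 2 => LinearMap.id + (q : ℂ) • flipTwo H
  | n + 3 => idTensor (lam q (n + 2))

lemma tensorPow_induction {n : ℕ} {P : TensorPow H (n + 1) → Prop} (x : TensorPow H (n + 1))
    (h0 : P 0) (ht : ∀ (f : H) (F : TensorPow H n), P (tmulLeft f n F))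
    (ha : ∀ x y, P x → P y → P (x + y)) : P x :=
  TensorProduct.induction_on (motive := P) x h0 ht ha

@[simp] lemma inner_tmulLeft {n : ℕ} (f g : H) (F G : TensorPow H n) :
    inner ℂ (tmulLeft f n F) (tmulLeft g n G) = inner ℂ f g * inner ℂ F G :=
  TensorProduct.inner_tmul ℂ f g F G

@[simp] lemma idTensor_tmulLeft {n : ℕ} (T : TensorPow H n →ₗ[ℂ] TensorPow H n) (f : H)
    (F : TensorPow H n) : idTensor T (tmulLeft f n F) = tmulLeft f n (T F) := rfl

@[simp] lemma flipTwo_tmulLeft (f g : H) (z : TensorPow H 0) :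
    flipTwo H (tmulLeft f 1 (tmulLeft g 0 z)) = tmulLeft g 1 (tmulLeft f 0 z) := rfl

lemma lam_two_tmulLeft (q : ℝ) (f g : H) (z : TensorPow H 0) :
    lam q 2 (tmulLeft f 1 (tmulLeft g 0 z)) =
      tmulLeft f 1 (tmulLeft g 0 z) + (q : ℂ) • tmulLeft g 1 (tmulLeft f 0 z) := rfl

lemma lam_tmulLeft (q : ℝ) (n : ℕ) (f : H) (F : TensorPow H (n + 2)) :
    lam q (n + 3) (tmulLeft f (n + 2) F) = tmulLeft f (n + 2) (lam q (n + 2) F) := rfl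

lemma tensorPow_two_induction {P : TensorPow H 2 → Prop} (x : TensorPow H 2)
    (h0 : P 0) (ht : ∀ (f g : H) (z : TensorPow H 0), P (tmulLeft f 1 (tmulLeft g 0 z)))
    (ha : ∀ x y, P x → P y → P (x + y)) : P x := by
  refine tensorPow_induction x h0 (fun f F => ?_) ha
  refine tensorPow_induction (P := fun F => P (tmulLeft f 1 F)) F ?_ (fun g z => ht f g z) ?_
  · simpa using h0
  · intro x y hx hy
    simpa using ha _ _ hx hy

/-- For `n ≥ 2`, `λₙ = 1 + q U` with `U` a self-adjoint isometric involution. -/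
lemma exists_lam_eq (q : ℝ) (n : ℕ) :
    ∃ U : TensorPow H (n + 2) →ₗ[ℂ] TensorPow H (n + 2),
      (∀ F, U (U F) = F) ∧ (∀ F G, inner ℂ (U F) (U G) = inner ℂ F G) ∧
      ∀ F, lam q (n + 2) F = F + (q : ℂ) • U F := by
  induction n with
  | zero =>
    refine ⟨flipTwo H, fun F => ?_, fun F G => ?_, fun F => rfl⟩
    · refine tensorPow_two_induction (P := fun F => flipTwo H (flipTwo H F) = F) F
        (by simp) (fun f g z => by simp) ?_
      intro x y hx hy
      rw [map_add, map_add, hx, hy]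
    · refine tensorPow_two_induction
        (P := fun F => inner ℂ (flipTwo H F) (flipTwo H G) = inner ℂ F G) F
        (by simp) (fun f g z => ?_) ?_
      · refine tensorPow_two_induction
          (P := fun G => inner ℂ (flipTwo H (tmulLeft f 1 (tmulLeft g 0 z))) (flipTwo H G) =
            inner ℂ (tmulLeft f 1 (tmulLeft g 0 z)) G) G (by simp) (fun f' g' z' => ?_) ?_
        · simp only [flipTwo_tmulLeft, inner_tmulLeft]; ring
        · intro x y hx hy
          rw [map_add, inner_add_right, inner_add_right, hx, hy]
      · intro x y hx hy
        rw [map_add, inner_add_left, inner_add_left, hx, hy]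
  | succ n ih =>
    obtain ⟨U, h1, h2, h3⟩ := ih
    have key : ∃ V : TensorPow H (n + 2 + 1) →ₗ[ℂ] TensorPow H (n + 2 + 1),
        (∀ F, V (V F) = F) ∧ (∀ F G, inner ℂ (V F) (V G) = inner ℂ F G) ∧
        ∀ F, lam q (n + 3) F = F + (q : ℂ) • V F := by
      refine ⟨idTensor U, fun F => ?_, fun F G => ?_, fun F => ?_⟩
      · refine tensorPow_induction (P := fun F => idTensor U (idTensor U F) = F) F
          (by simp) (fun f x => by simp [h1]) ?_
        intro x y hx hy
        rw [map_add, map_add, hx, hy]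
      · refine tensorPow_induction
          (P := fun F => inner ℂ (idTensor U F) (idTensor U G) = inner ℂ F G) F
          (by simp) (fun f x => ?_) ?_
        · refine tensorPow_induction
            (P := fun G => inner ℂ (idTensor U (tmulLeft f (n + 2) x)) (idTensor U G) =
              inner ℂ (tmulLeft f (n + 2) x) G) G (by simp) (fun g y => by simp [h2]) ?_
          intro x y hx hy
          rw [map_add, inner_add_right, inner_add_right, hx, hy]
        · intro x y hx hy
          rw [map_add, inner_add_left, inner_add_left, hx, hy]
      · refine tensorPow_induction
          (P := fun F => lam q (n + 3) F = F + (q : ℂ) • idTensor U F) F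
          (by simp) (fun f x => ?_) ?_
        · rw [lam_tmulLeft, h3, idTensor_tmulLeft, map_add, map_smul]
        · intro x y hx hy
          rw [map_add, map_add, hx, hy, smul_add]
          abel
    exact key

lemma lam_symmetric (q : ℝ) (n : ℕ) (F G : TensorPow H n) :
    inner ℂ (lam q n F) G = inner ℂ F (lam q n G) := by
  match n, F, G with
  | 0, F, G => rfl
  | 1, F, G => rfl
  | n + 2, F, G =>
    obtain ⟨U, h1, h2, h3⟩ := exists_lam_eq (H := H) q n
    have hU : inner ℂ (U F) G = inner ℂ F (U G) := by rw [← h2 F (U G), h1]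
    rw [h3, h3, inner_add_left, inner_add_right, inner_smul_left, inner_smul_right, hU,
      Complex.conj_ofReal]

lemma norm_inner_involution {n : ℕ} {U : TensorPow H n →ₗ[ℂ] TensorPow H n}
    (h2 : ∀ F G, inner ℂ (U F) (U G) = inner ℂ F G) (F : TensorPow H n) :
    |(inner ℂ F (U F)).re| ≤ ‖F‖ ^ 2 := by
  have hn : ‖U F‖ = ‖F‖ := by
    rw [norm_eq_sqrt_re_inner (𝕜 := ℂ) (U F), norm_eq_sqrt_re_inner (𝕜 := ℂ) F, h2]
  calc |(inner ℂ F (U F)).re| ≤ ‖inner ℂ F (U F)‖ := Complex.abs_re_le_norm _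
    _ ≤ ‖F‖ * ‖U F‖ := norm_inner_le_norm _ _
    _ = ‖F‖ ^ 2 := by rw [hn, sq]

lemma re_inner_lam_eq {q : ℝ} {n : ℕ} {U : TensorPow H (n + 2) →ₗ[ℂ] TensorPow H (n + 2)}
    (h3 : ∀ F, lam q (n + 2) F = F + (q : ℂ) • U F) (F : TensorPow H (n + 2)) :
    (inner ℂ F (lam q (n + 2) F)).re = ‖F‖ ^ 2 + q * (inner ℂ F (U F)).re := by
  rw [h3, inner_add_right, inner_smul_right, Complex.add_re, Complex.re_ofReal_mul]
  congr 1
  exact (norm_sq_eq_re_inner (𝕜 := ℂ) F).symm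

lemma lam_nonneg {q : ℝ} (hq : q ∈ Set.Icc (-1 : ℝ) 1) (n : ℕ) (F : TensorPow H n) :
    0 ≤ (inner ℂ F (lam q n F)).re := by
  match n, F with
  | 0, F => exact inner_self_nonneg (𝕜 := ℂ) (x := F)
  | 1, F => exact inner_self_nonneg (𝕜 := ℂ) (x := F)
  | n + 2, F =>
    obtain ⟨U, h1, h2, h3⟩ := exists_lam_eq (H := H) q n
    have h := norm_inner_involution h2 F
    rw [re_inner_lam_eq h3]
    have hq' : |q| ≤ 1 := abs_le.2 hq
    have : |q * (inner ℂ F (U F)).re| ≤ ‖F‖ ^ 2 := by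
      rw [abs_mul]
      calc _ ≤ 1 * ‖F‖ ^ 2 := mul_le_mul hq' h (abs_nonneg _) zero_le_one
        _ = _ := one_mul _
    linarith [neg_abs_le (q * (inner ℂ F (U F)).re)]

lemma lam_tmulLeft_le {q : ℝ} (hq : q ∈ Set.Icc (-1 : ℝ) 1) (n : ℕ) (f : H)
    (F : TensorPow H n) :
    (inner ℂ (tmulLeft f n F) (lam q (n + 1) (tmulLeft f n F))).re ≤
      2 * ‖f‖ ^ 2 * (inner ℂ F (lam q n F)).re := by
  have hf : inner ℂ f f = ((‖f‖ ^ 2 : ℝ) : ℂ) := by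
    rw [inner_self_eq_norm_sq_to_K]; norm_cast
  have key : ∀ (m : ℕ) (G : TensorPow H m), ‖tmulLeft f m G‖ ^ 2 = ‖f‖ ^ 2 * ‖G‖ ^ 2 := by
    intro m G
    rw [@norm_sq_eq_re_inner ℂ _ _ _ _ (tmulLeft f m G), inner_tmulLeft, hf,
      @norm_sq_eq_re_inner ℂ _ _ _ _ G]
    exact Complex.re_ofReal_mul _ _
  match n, F with
  | 0, F =>
    have h := key 0 F
    have e1 : (inner ℂ (tmulLeft f 0 F) (lam q 1 (tmulLeft f 0 F))).re = ‖tmulLeft f 0 F‖ ^ 2 :=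
      (norm_sq_eq_re_inner (𝕜 := ℂ) (tmulLeft f 0 F)).symm
    have e2 : (inner ℂ F (lam q 0 F)).re = ‖F‖ ^ 2 := (norm_sq_eq_re_inner (𝕜 := ℂ) F).symm
    rw [e1, e2, h]
    nlinarith [mul_nonneg (sq_nonneg ‖f‖) (sq_nonneg ‖F‖)]
  | 1, F =>
    have h := key 1 F
    obtain ⟨U, h1, h2, h3⟩ := exists_lam_eq (H := H) q 0
    have e2 : (inner ℂ F (lam q 1 F)).re = ‖F‖ ^ 2 := (norm_sq_eq_re_inner (𝕜 := ℂ) F).symm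
    have h4 := norm_inner_involution h2 (tmulLeft f 1 F)
    have hq' : |q| ≤ 1 := abs_le.2 hq
    have : |q * (inner ℂ (tmulLeft f 1 F) (U (tmulLeft f 1 F))).re| ≤ ‖tmulLeft f 1 F‖ ^ 2 := by
      rw [abs_mul]
      calc _ ≤ 1 * ‖tmulLeft f 1 F‖ ^ 2 := mul_le_mul hq' h4 (abs_nonneg _) zero_le_one
        _ = _ := one_mul _
    have e1 := re_inner_lam_eq h3 (tmulLeft f 1 F)
    rw [e2]
    have e1' : (inner ℂ (tmulLeft f 1 F) (lam q (1 + 1) (tmulLeft f 1 F))).re =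
      ‖tmulLeft f 1 F‖ ^ 2 + q * (inner ℂ (tmulLeft f 1 F) (U (tmulLeft f 1 F))).re := e1
    rw [e1']
    linarith [le_abs_self (q * (inner ℂ (tmulLeft f 1 F) (U (tmulLeft f 1 F))).re)]
  | n + 2, F =>
    rw [lam_tmulLeft, inner_tmulLeft, hf, Complex.re_ofReal_mul]
    nlinarith [mul_nonneg (sq_nonneg ‖f‖) (lam_nonneg hq (n + 2) F)]

end

/-! ## The `n`-particle spaces -/

section

variable (q : Set.Icc (-1 : ℝ) 1) (H : Type u) [NormedAddCommGroup H] [InnerProductSpace ℂ H]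

/-- `H^{⊗n}`, to be equipped with the semi-inner product `⟪F, λₙ G⟫`. -/
def DeformedPow (_q : Set.Icc (-1 : ℝ) 1) (H : Type u) [NormedAddCommGroup H]
    [InnerProductSpace ℂ H] (n : ℕ) : Type u := TensorPow H n

instance (n : ℕ) : AddCommGroup (DeformedPow q H n) :=
  inferInstanceAs (AddCommGroup (TensorPow H n))

instance (n : ℕ) : Module ℂ (DeformedPow q H n) :=
  inferInstanceAs (Module ℂ (TensorPow H n))

/-- The identity map `H^{⊗n} → (H^{⊗n}, ⟪·, λₙ ·⟫)`. -/
def toDeformed (n : ℕ) : TensorPow H n ≃ₗ[ℂ] DeformedPow q H n :=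
  LinearEquiv.refl ℂ (TensorPow H n)

/-- The semi-inner product `⟪F, G⟫ₙ = ⟪F, λₙ G⟫` on `H^{⊗n}`. -/
abbrev deformedCore (n : ℕ) : PreInnerProductSpace.Core ℂ (DeformedPow q H n) where
  inner F G := inner ℂ ((toDeformed q H n).symm F) (lam q n ((toDeformed q H n).symm G))
  conj_inner_symm F G := by
    rw [inner_conj_symm, lam_symmetric]
  re_inner_nonneg F := lam_nonneg q.2 n _
  add_left F G K := by rw [map_add, inner_add_left]
  smul_left F G r := by rw [map_smul, inner_smul_left]

instance (n : ℕ) : SeminormedAddCommGroup (DeformedPow q H n) :=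
  @InnerProductSpace.Core.toSeminormedAddCommGroup ℂ _ _ _ _ (deformedCore q H n)

instance (n : ℕ) : InnerProductSpace ℂ (DeformedPow q H n) :=
  InnerProductSpace.ofCore (deformedCore q H n)

lemma inner_toDeformed (n : ℕ) (F G : TensorPow H n) :
    inner ℂ (toDeformed q H n F) (toDeformed q H n G) = inner ℂ F (lam q n G) := rfl

/-- The `n`-particle space: the Hilbert space obtained from `H^{⊗n}` with the semi-inner product
`⟪·, λₙ ·⟫` by dividing by the kernel and completing (`UniformSpace.Completion` is the Hausdorff
completion, hence does both). -/
abbrev ParticleSpace (n : ℕ) : Type u := UniformSpace.Completion (DeformedPow q H n)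

/-- The class in the `n`-particle space of an element of `H^{⊗n}`. -/
def toParticle (n : ℕ) (F : TensorPow H n) : ParticleSpace q H n :=
  ((toDeformed q H n F : DeformedPow q H n) : UniformSpace.Completion (DeformedPow q H n))

/-! ## The Fock space and its operators -/

/-- The `(q,2)`-Fock space: the Hilbert direct sum of the `n`-particle spaces. -/
abbrev Fock : Type u := lp (fun n : ℕ => ParticleSpace q H n) 2

/-- The vacuum vector `Φ = 1 ⊕ 0 ⊕ 0 ⊕ ⋯`. -/
def vacuum : Fock q H := lp.single 2 0 (toParticle q H 0 (unitVec H))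

end

section

variable {q : Set.Icc (-1 : ℝ) 1} {H : Type u} [NormedAddCommGroup H] [InnerProductSpace ℂ H]

lemma norm_deformed_tmulLeft_le (f : H) (n : ℕ) (F : DeformedPow q H n) :
    ‖toDeformed q H (n + 1) (tmulLeft f n ((toDeformed q H n).symm F))‖ ≤
      (√2 * ‖f‖) * ‖F‖ := by
  have h := lam_tmulLeft_le q.2 n f ((toDeformed q H n).symm F)
  have e1 : ‖toDeformed q H (n + 1) (tmulLeft f n ((toDeformed q H n).symm F))‖ ^ 2 =
      (inner ℂ (tmulLeft f n ((toDeformed q H n).symm F))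
        (lam q (n + 1) (tmulLeft f n ((toDeformed q H n).symm F)))).re :=
    norm_sq_eq_re_inner (𝕜 := ℂ)
      (toDeformed q H (n + 1) (tmulLeft f n ((toDeformed q H n).symm F)))
  have e2 : ‖F‖ ^ 2 =
      (inner ℂ ((toDeformed q H n).symm F) (lam q n ((toDeformed q H n).symm F))).re :=
    norm_sq_eq_re_inner (𝕜 := ℂ) F
  refine le_of_sq_le_sq ?_ (by positivity)
  rw [e1, mul_pow, mul_pow, e2, Real.sq_sqrt (by norm_num)]
  exact h

/-- `F ↦ f ⊗ F` on the spaces `(H^{⊗n}, ⟪·, λₙ ·⟫)`. -/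
def deformedCreation (f : H) (n : ℕ) : DeformedPow q H n →L[ℂ] DeformedPow q H (n + 1) :=
  LinearMap.mkContinuous
    ((toDeformed q H (n + 1)).toLinearMap ∘ₗ tmulLeft f n ∘ₗ (toDeformed q H n).symm.toLinearMap)
    (√2 * ‖f‖) (norm_deformed_tmulLeft_le f n)

/-- `F ↦ f ⊗ F` from the `n`-particle space to the `(n+1)`-particle space (continuous
extension from the dense image of `H^{⊗n}`). -/
def creationPart (f : H) (n : ℕ) : ParticleSpace q H n →L[ℂ] ParticleSpace q H (n + 1) :=
  (deformedCreation f n).completion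

lemma creationPart_toParticle (f : H) (n : ℕ) (F : TensorPow H n) :
    creationPart f n (toParticle q H n F) = toParticle q H (n + 1) (tmulLeft f n F) :=
  ContinuousLinearMap.completion_apply_coe _ _

lemma norm_creationPart_le (f : H) (n : ℕ) (F : ParticleSpace q H n) :
    ‖creationPart f n F‖ ≤ (√2 * ‖f‖) * ‖F‖ := by
  refine UniformSpace.Completion.induction_on F
    (isClosed_le (by fun_prop) (by fun_prop)) (fun x => ?_)
  have : creationPart f n (x : ParticleSpace q H n) =
      ((deformedCreation f n x : DeformedPow q H (n + 1)) : ParticleSpace q H (n + 1)) :=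
    ContinuousLinearMap.completion_apply_coe _ _
  rw [this, UniformSpace.Completion.norm_coe, UniformSpace.Completion.norm_coe]
  exact norm_deformed_tmulLeft_le f n x

/-- The sequence `(0, f ⊗ F₀, f ⊗ F₁, …)`. -/
def creationSeq (f : H) (F : (n : ℕ) → ParticleSpace q H n) : (n : ℕ) → ParticleSpace q H n
  | 0 => 0
  | n + 1 => creationPart f n (F n)

lemma hasSum_creationSeq_bound (f : H) (F : Fock q H) :
    Summable (fun n => ‖creationSeq f F n‖ ^ 2) ∧
      ∑' n, ‖creationSeq f F n‖ ^ 2 ≤ ((√2 * ‖f‖) * ‖F‖) ^ 2 := by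
  have hF : HasSum (fun n => ‖F n‖ ^ 2) (‖F‖ ^ 2) := by
    simpa using lp.hasSum_norm (p := 2) (by norm_num) F
  have hb : ∀ n, ‖creationSeq f F (n + 1)‖ ^ 2 ≤ (√2 * ‖f‖) ^ 2 * ‖F n‖ ^ 2 := fun n => by
    rw [← mul_pow]
    exact pow_le_pow_left₀ (norm_nonneg _) (norm_creationPart_le f n (F n)) 2
  have hs : Summable (fun n => ‖creationSeq f F (n + 1)‖ ^ 2) :=
    Summable.of_nonneg_of_le (fun _ => by positivity) hb (hF.summable.mul_left _)
  have hs' : Summable (fun n => ‖creationSeq f F n‖ ^ 2) := (summable_nat_add_iff 1).1 hs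
  refine ⟨hs', ?_⟩
  rw [hs'.tsum_eq_zero_add]
  have h0 : ‖creationSeq f F 0‖ ^ 2 = 0 := by
    have h00 : creationSeq f F 0 = 0 := rfl
    rw [h00, norm_zero, sq, zero_mul]
  rw [h0, zero_add, mul_pow, ← hF.tsum_eq, ← tsum_mul_left]
  exact hs.tsum_le_tsum hb (hF.summable.mul_left _)

/-- The creation operator `A⁺(f)` on the `(q,2)`-Fock space: `A⁺(f) F = f ⊗ F` on every
`n`-particle space (in particular `A⁺(f) Φ = f`), a bounded linear operator. -/
def creation (f : H) : Fock q H →L[ℂ] Fock q H :=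
  LinearMap.mkContinuous
    { toFun := fun F => ⟨creationSeq f F,
        memℓp_gen (by simpa using (hasSum_creationSeq_bound f F).1)⟩
      map_add' := fun F G => by
        ext n
        cases n with
        | zero => exact (add_zero (0 : ParticleSpace q H 0)).symm
        | succ n => exact map_add (creationPart f n) (F n) (G n)
      map_smul' := fun c F => by
        ext n
        cases n with
        | zero => exact (smul_zero (A := ParticleSpace q H 0) c).symm
        | succ n => exact map_smul (creationPart f n) c (F n) }
    (√2 * ‖f‖) (fun F => by
      refine lp.norm_le_of_tsum_le (p := 2) (by norm_num) (by positivity) ?_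
      simpa using (hasSum_creationSeq_bound f F).2)

/-- The annihilation operator `A(f) = A⁺(f)^*`. -/
def annihilation (f : H) : Fock q H →L[ℂ] Fock q H :=
  ContinuousLinearMap.adjoint (creation f)

/-- The field operator `Q(f) = A(f) + A⁺(f)`. -/
def fieldOp (f : H) : Fock q H →L[ℂ] Fock q H := annihilation f + creation f

/-- `μ` is the distribution of the bounded self-adjoint operator `X` in the vacuum state
`⟪Φ, · Φ⟫`: the (unique) compactly supported probability measure on `ℝ` whose moments are
`⟪Φ, X^k Φ⟫`. -/
structure IsVacuumDistribution (X : Fock q H →L[ℂ] Fock q H)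
    (μ : MeasureTheory.Measure ℝ) : Prop where
  isProbabilityMeasure : MeasureTheory.IsProbabilityMeasure μ
  bounded_support : ∃ R : ℝ, μ (Set.Icc (-R) R)ᶜ = 0
  moment : ∀ k : ℕ, ((∫ x, x ^ k ∂μ : ℝ) : ℂ) = inner ℂ (vacuum q H) ((X ^ k) (vacuum q H))

end

/-! ## The functions and constants of the distribution -/

/-- The function `p_a`. -/
def pDensity (a : ℝ) : ℝ → ℝ :=
  (Set.Ioo (0 : ℝ) 1).indicator fun x =>
    2 * a / Real.pi *
      (√(1 - x) / (√x * (1 + 4 * (a - 1) * (a + 2) * x - 16 * (a - 1) * x ^ 2)))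

/-- The number `a₁` (used for `a > 1`). -/
def aOne (a : ℝ) : ℝ := (√((a + 2) ^ 2 + 4 / (a - 1)) + a + 2) / 8

/-- The number `a₂` (used for `a > 1`). -/
def aTwo (a : ℝ) : ℝ := (√((a + 2) ^ 2 + 4 / (a - 1)) - a - 2) / 8

/-- The number `A₁` (used for `a > 1`). -/
def bigAOne (a : ℝ) : ℝ :=
  16 * (a - 1) - 2 * a / (aOne a + aTwo a) *
    (√((aTwo a + 1) / aTwo a) - √((aOne a - 1) / aOne a))

end QTwoFock

end

/-! The vectors `f^{⊗n}` span a space on which creation is the shift and annihilation a weighted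
backward shift: since `λₙ` only touches the last two tensor factors, every weight is `‖f‖² = 1/4`,
except the one from `f ⊗ f` to `f`, which is `a/4`. Hence `Q(f)²` acts on the even vectors as a
Jacobi matrix, with polynomials `Pₙ = evenOrtho a n` satisfying `Pₙ(Q(f)²) Φ = 4ⁿ f^{⊗2n}`. A
compactly supported `μ` of mass one therefore has the right moments once `∫ Pₙ dμ = 0` for `n ≥ 1`
(`integral_pow_mul_evenOrtho`).

The density satisfies `denom a · p_a = a · p₁`, where `p₁` is the law of the square of a
semicircular variable, orthogonal to the nonconstant polynomials `Wₙ = evenChebyshev n`. As `denom a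
· Wₙ₊₁ = Pₙ₊₁ + (1 - a)(Pₙ₊₂ + Pₙ₊₃)`, this orthogonality is a recursion for the integrals of the
`Pₙ`; mass one, mean `1/4` and `∫ denom a dμ = a` start it (`integral_evenOrtho_eq_zero`). An atom
at a zero of `denom a` disturbs none of the integrals containing `denom a`, so only mass and mean
must be balanced.

These two integrals become rational under `x = 1/(1 + t²)`. With `s = |3 - 2a|` and `u² = 4a² + 4a -
6 + 2s` the mass of `p_a` is `2a/u` (`integrable_and_integral_pDensity`). The absolute value
produces the threshold: `u = 2a` for `a ≤ 3/2`, while for `a > 3/2` one gets `u = 2√((a+3)(a-1)) >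
2a`, and the missing mass sits at the zero `a₁ > 1` of `denom a` (`bigAOne_div`). -/

namespace QTwoFock

/-! ### The field operator on the vectors `f^{⊗n}` -/

section

variable {H : Type u} [NormedAddCommGroup H] [InnerProductSpace ℂ H]

/-- The tensor power `f^{⊗n}`. -/
noncomputable def tensorPower (f : H) : (n : ℕ) → TensorPow H n
  | 0 => unitVec H
  | n + 1 => tmulLeft f n (tensorPower f n)

/-- For `n ≥ 2` the first factor is untouched by `λₙ₊₁` and splits off; for `n = 1` the flip fixes
`f ⊗ f`, whence the factor `1 + q`. Leaving `G` arbitrary determines the adjoint of creation on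
`f^{⊗(n+1)}` completely. -/
lemma inner_tmulLeft_lam_tensorPower (q : ℝ) (f : H) (n : ℕ) (G : TensorPow H n) :
    inner ℂ (tmulLeft f n G) (lam q (n + 1) (tensorPower f (n + 1))) =
      (((if n = 1 then 1 + q else 1) * ‖f‖ ^ 2 : ℝ) : ℂ) *
        inner ℂ G (lam q n (tensorPower f n)) := by
  have hf : inner ℂ f f = ((‖f‖ ^ 2 : ℝ) : ℂ) := by
    rw [inner_self_eq_norm_sq_to_K]; norm_cast
  match n, G with
  | 0, G =>
    change inner ℂ (tmulLeft f 0 G) (tmulLeft f 0 (tensorPower f 0)) =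
      _ * inner ℂ G (tensorPower f 0)
    rw [inner_tmulLeft, hf]
    simp
  | 1, G =>
    refine tensorPow_induction (P := fun G => inner ℂ (tmulLeft f 1 G)
      (lam q 2 (tmulLeft f 1 (tmulLeft f 0 (tensorPower f 0)))) =
        _ * inner ℂ G (tmulLeft f 0 (tensorPower f 0))) G ?_ (fun g z => ?_) ?_
    · simp
    · rw [lam_two_tmulLeft, inner_add_right, inner_smul_right, inner_tmulLeft, inner_tmulLeft, hf]
      simp only [if_true]
      push_cast
      ring
    · intro x y hx hy
      rw [map_add, inner_add_left, inner_add_left, hx, hy, mul_add]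
  | n + 2, G =>
    change inner ℂ (tmulLeft f (n + 2) G) (lam q (n + 3) (tmulLeft f (n + 2) _)) = _
    rw [lam_tmulLeft, inner_tmulLeft, hf]
    simp

variable {q : Set.Icc (-1 : ℝ) 1}

lemma inner_toParticle (n : ℕ) (F G : TensorPow H n) :
    inner ℂ (toParticle q H n F) (toParticle q H n G) = inner ℂ F (lam q n G) := by
  rw [toParticle, toParticle, UniformSpace.Completion.inner_coe, inner_toDeformed]

lemma inner_creationPart_tensorPower (f : H) (n : ℕ) (F : ParticleSpace q H n) :
    inner ℂ (creationPart f n F) (toParticle q H (n + 1) (tensorPower f (n + 1))) =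
      (((if n = 1 then 1 + (q : ℝ) else 1) * ‖f‖ ^ 2 : ℝ) : ℂ) *
        inner ℂ F (toParticle q H n (tensorPower f n)) := by
  refine UniformSpace.Completion.induction_on F
    (isClosed_eq (by fun_prop) (by fun_prop)) (fun x => ?_)
  have h := creationPart_toParticle (q := q) f n ((toDeformed q H n).symm x)
  have hx : toParticle q H n ((toDeformed q H n).symm x) = (x : ParticleSpace q H n) := rfl
  rw [← hx, h, inner_toParticle, inner_toParticle]
  exact inner_tmulLeft_lam_tensorPower q f n _

variable (q) in
/-- The vector `f^{⊗n}` of the Fock space. -/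
noncomputable def numberVec (f : H) (n : ℕ) : Fock q H :=
  lp.single 2 n (toParticle q H n (tensorPower f n))

lemma numberVec_zero (f : H) : numberVec q f 0 = vacuum q H := rfl

lemma creation_apply_succ (f : H) (F : Fock q H) (n : ℕ) :
    creation f F (n + 1) = creationPart f n (F n) := rfl

lemma creation_apply_zero (f : H) (F : Fock q H) : creation f F 0 = 0 := rfl

lemma creation_numberVec (f : H) (n : ℕ) :
    creation f (numberVec q f n) = numberVec q f (n + 1) := by
  ext m
  cases m with
  | zero =>
    rw [creation_apply_zero, numberVec, lp.single_apply, Pi.single_eq_of_ne (by omega)]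
  | succ m =>
    rw [creation_apply_succ, numberVec, numberVec, lp.single_apply, lp.single_apply]
    by_cases h : m = n
    · subst h
      rw [Pi.single_eq_same, Pi.single_eq_same, creationPart_toParticle]
      rfl
    · rw [Pi.single_eq_of_ne h, Pi.single_eq_of_ne (by omega), map_zero]

lemma annihilation_numberVec_succ (f : H) (n : ℕ) :
    annihilation f (numberVec q f (n + 1)) =
      (((if n = 1 then 1 + (q : ℝ) else 1) * ‖f‖ ^ 2 : ℝ) : ℂ) • numberVec q f n := by
  refine ext_inner_left ℂ fun F => ?_
  rw [annihilation, ContinuousLinearMap.adjoint_inner_right, inner_smul_right, numberVec,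
    numberVec, lp.inner_single_right, lp.inner_single_right, creation_apply_succ,
    inner_creationPart_tensorPower]

lemma annihilation_numberVec_zero (f : H) : annihilation f (numberVec q f 0) = 0 := by
  refine ext_inner_left ℂ fun F => ?_
  rw [annihilation, ContinuousLinearMap.adjoint_inner_right, numberVec, lp.inner_single_right,
    creation_apply_zero, inner_zero_left, inner_zero_right]

lemma inner_vacuum_self : inner ℂ (vacuum q H) (vacuum q H) = 1 := by
  rw [vacuum, lp.inner_single_right, lp.single_apply, Pi.single_eq_same, inner_toParticle]
  change inner ℂ (unitVec H) (unitVec H) = 1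
  rw [unitVec, LinearIsometryEquiv.inner_map_map]
  simp

lemma inner_vacuum_numberVec_succ (f : H) (n : ℕ) :
    inner ℂ (vacuum q H) (numberVec q f (n + 1)) = 0 := by
  rw [numberVec, lp.inner_single_right, vacuum, lp.single_apply, Pi.single_eq_of_ne (by omega),
    inner_zero_left]

/-- This and the next two lemmas give the rows of the Jacobi matrix of `Q(f)²`. The first two are
exceptional: the vacuum is annihilated, and the path through `f ⊗ f` meets the weight `(1 + q)/4`.
-/
lemma fieldOp_sq_numberVec_zero {f : H} (hf : ‖f‖ = 1 / 2) :
    (fieldOp (q := q) f ^ 2) (numberVec q f 0) =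
      numberVec q f 2 + (1 / 4 : ℂ) • numberVec q f 0 := by
  simp only [pow_two, mul_apply_eq_comp, fieldOp, add_apply,
    annihilation_numberVec_zero, creation_numberVec, map_add, map_zero,
    annihilation_numberVec_succ, hf]
  norm_num
  abel

lemma fieldOp_sq_numberVec_two {f : H} (hf : ‖f‖ = 1 / 2) :
    (fieldOp (q := q) f ^ 2) (numberVec q f 2) =
      numberVec q f 4 + ((2 + (q : ℝ)) / 4 : ℂ) • numberVec q f 2 +
        ((1 + (q : ℝ)) / 16 : ℂ) • numberVec q f 0 := by
  simp only [pow_two, mul_apply_eq_comp, fieldOp, add_apply,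
    creation_numberVec, map_add, map_smul, annihilation_numberVec_succ, hf]
  norm_num
  module

lemma fieldOp_sq_numberVec_add_four {f : H} (hf : ‖f‖ = 1 / 2) (n : ℕ) :
    (fieldOp (q := q) f ^ 2) (numberVec q f (n + 4)) =
      numberVec q f (n + 6) + (1 / 2 : ℂ) • numberVec q f (n + 4) +
        (1 / 16 : ℂ) • numberVec q f (n + 2) := by
  have hA : ∀ m, annihilation f (numberVec q f (m + 3)) = (1 / 4 : ℂ) • numberVec q f (m + 2) := by
    intro m
    rw [annihilation_numberVec_succ, if_neg (by omega), hf]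
    norm_num
  simp only [pow_two, mul_apply_eq_comp, fieldOp, add_apply, map_add]
  rw [hA (n + 1), creation_numberVec, hA (n + 2), map_smul, map_smul, hA n, creation_numberVec,
    creation_numberVec]
  module

end

/-! ## Orthogonal polynomials -/

/-- The polynomials `Uₙ(2 y - 1) + Uₙ₋₁(2 y - 1)`, that is `U₂ₙ(√y)` with `U` the Chebyshev
polynomials of the second kind. -/
noncomputable def evenChebyshev : ℕ → ℝ → ℝ
  | 0, _ => 1
  | 1, x => 4 * x - 1
  | n + 2, x => (4 * x - 2) * evenChebyshev (n + 1) x - evenChebyshev n x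

/-- Orthogonal polynomials for the distribution of `Q(f)²`. -/
noncomputable def evenOrtho (a : ℝ) : ℕ → ℝ → ℝ
  | 0, _ => 1
  | 1, x => 4 * x - 1
  | 2, x => 16 * x ^ 2 - (8 + 4 * a) * x + 1
  | n + 3, x => (4 * x - 2) * evenOrtho a (n + 2) x - evenOrtho a (n + 1) x

/-- The quadratic polynomial in the denominator of the density. -/
noncomputable def denom (a x : ℝ) : ℝ := 1 + 4 * (a - 1) * (a + 2) * x - 16 * (a - 1) * x ^ 2

@[fun_prop]
lemma continuous_evenChebyshev (n : ℕ) : Continuous (evenChebyshev n) := by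
  induction n using Nat.twoStepInduction with
  | zero => exact continuous_const
  | one => exact (continuous_const.mul continuous_id).sub continuous_const
  | more n h1 h2 =>
    exact (((continuous_const.mul continuous_id).sub continuous_const).mul h2).sub h1

@[fun_prop]
lemma continuous_evenOrtho (a : ℝ) (n : ℕ) : Continuous (evenOrtho a n) := by
  have h1 : Continuous (evenOrtho a 1) :=
    show Continuous fun x : ℝ => 4 * x - 1 by fun_prop
  -- The recursion only starts at index 3, so three consecutive indices are carried along.
  have h : Continuous (evenOrtho a n) ∧ Continuous (evenOrtho a (n + 1)) ∧
      Continuous (evenOrtho a (n + 2)) := by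
    induction n with
    | zero =>
      exact ⟨continuous_const, h1,
        show Continuous fun x : ℝ => 16 * x ^ 2 - (8 + 4 * a) * x + 1 by fun_prop⟩
    | succ n ih =>
      obtain ⟨-, h2, h3⟩ := ih
      exact ⟨h2, h3, show Continuous fun x => (4 * x - 2) * evenOrtho a (n + 2) x -
        evenOrtho a (n + 1) x by fun_prop⟩
  exact h.1

@[fun_prop]
lemma continuous_denom (a : ℝ) : Continuous (denom a) := by
  unfold denom; fun_prop

/-- Both families obey `yₙ₊₂ = (4x - 2) yₙ₊₁ - yₙ` in this index range, so two initial cases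
suffice. The index starts at `n + 1`; the counterpart for `W₀ = 1` is `denom_eq`. -/
lemma denom_mul_evenChebyshev (a x : ℝ) (n : ℕ) :
    denom a x * evenChebyshev (n + 1) x =
      evenOrtho a (n + 1) x + (1 - a) * (evenOrtho a (n + 2) x + evenOrtho a (n + 3) x) := by
  induction n using Nat.twoStepInduction with
  | zero => simp only [denom, evenChebyshev, evenOrtho]; ring
  | one => simp only [denom, evenChebyshev, evenOrtho]; ring
  | more n h1 h2 =>
    simp only [evenChebyshev, evenOrtho] at *
    linear_combination (4 * x - 2) * h2 - h1

lemma denom_eq (a x : ℝ) : denom a x = a - (a - 1) * evenOrtho a 2 x := by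
  simp only [denom, evenOrtho]; ring

/-! ### From polynomial integrals to vacuum moments -/

open MeasureTheory

lemma integral_evenOrtho_eq_zero {a : ℝ} {μ : Measure ℝ}
    (hint : ∀ g : ℝ → ℝ, Continuous g → Integrable g μ)
    (h0 : ∫ _, (1 : ℝ) ∂μ = 1) (h1 : a ≠ 1 → ∫ x, x ∂μ = 1 / 4)
    (hD0 : ∫ x, denom a x ∂μ = a)
    (hD : ∀ n, ∫ x, denom a x * evenChebyshev (n + 1) x ∂μ = 0) (n : ℕ) :
    ∫ x, evenOrtho a (n + 1) x ∂μ = 0 := by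
  have hrec : ∀ n, ∫ x, evenOrtho a (n + 1) x ∂μ +
      (1 - a) * (∫ x, evenOrtho a (n + 2) x ∂μ + ∫ x, evenOrtho a (n + 3) x ∂μ) = 0 := by
    intro n
    have i := fun n => hint _ (continuous_evenOrtho a n)
    rw [← hD n]
    simp_rw [denom_mul_evenChebyshev]
    rw [integral_add (i _) (hint _ (by fun_prop)), integral_const_mul, integral_add (i _) (i _)]
  -- For `a = 1` the recursion decouples and each integral vanishes by itself, so no mean is needed.
  by_cases ha : a = 1
  · have := hrec n
    rw [ha] at this ⊢
    linarith
  -- Two consecutive zeros force the next one, since `1 - a ≠ 0`.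
  have key : ∫ x, evenOrtho a (n + 1) x ∂μ = 0 ∧ ∫ x, evenOrtho a (n + 2) x ∂μ = 0 := by
    induction n with
    | zero =>
      constructor
      · simp only [evenOrtho]
        rw [integral_sub (hint _ (by fun_prop)) (hint _ continuous_const),
          integral_const_mul, h0, h1 ha]
        norm_num
      · simp_rw [denom_eq] at hD0
        have e : (fun _ : ℝ => a) = fun _ => a * 1 := by simp
        rw [integral_sub (hint _ continuous_const)
          ((hint _ (continuous_evenOrtho a 2)).const_mul _), integral_const_mul, e,
          integral_const_mul, h0] at hD0
        have : (a - 1) * ∫ x, evenOrtho a 2 x ∂μ = 0 := by linarith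
        exact (mul_eq_zero.1 this).resolve_left (sub_ne_zero.2 ha)
    | succ n ih =>
      refine ⟨ih.2, ?_⟩
      have h := hrec n
      rw [ih.1, ih.2, zero_add, zero_add] at h
      exact (mul_eq_zero.1 h).resolve_left (sub_ne_zero.2 (Ne.symm ha))
  exact key.1

/-- Multiplication by `x` on `Pₙ` and `Q(f)²` on `4ⁿ f^{⊗2n}` have the same three-term recurrence,
so induction on `k` for all `n` at once reduces to `k = 0`, where both sides are `1` or `0`. The
case `n = 0` yields the moments. -/
lemma integral_pow_mul_evenOrtho {H : Type u} [NormedAddCommGroup H] [InnerProductSpace ℂ H]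
    {q : Set.Icc (-1 : ℝ) 1} {a : ℝ} (hq : (q : ℝ) = a - 1) {f : H} (hf : ‖f‖ = 1 / 2)
    {μ : Measure ℝ} (hint : ∀ g : ℝ → ℝ, Continuous g → Integrable g μ)
    (h0 : ∫ _, (1 : ℝ) ∂μ = 1) (h1 : ∀ n, ∫ x, evenOrtho a (n + 1) x ∂μ = 0) (k n : ℕ) :
    ((∫ x, x ^ k * evenOrtho a n x ∂μ : ℝ) : ℂ) =
      4 ^ n * inner ℂ (vacuum q H) (((fieldOp (q := q) f ^ 2) ^ k) (numberVec q f (2 * n))) := by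
  induction k generalizing n with
  | zero =>
    simp only [pow_zero, one_mul, one_apply_eq_self]
    cases n with
    | zero =>
      simp only [evenOrtho, h0, mul_zero, numberVec_zero, inner_vacuum_self]
      simp
    | succ n =>
      rw [h1, show 2 * (n + 1) = (2 * n + 1) + 1 by ring, inner_vacuum_numberVec_succ]
      simp
  | succ k ih =>
    have i : ∀ k n, Integrable (fun x => x ^ k * evenOrtho a n x) μ := fun k n =>
      hint _ ((continuous_pow k).mul (continuous_evenOrtho a n))
    have lin : ∀ (n n1 n2 : ℕ) (c1 c2 : ℝ),
        (∀ x, x * evenOrtho a n x = 1 / 4 * evenOrtho a (n + 1) x + c1 * evenOrtho a n1 x +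
          c2 * evenOrtho a n2 x) →
        ∫ x, x ^ (k + 1) * evenOrtho a n x ∂μ = 1 / 4 * ∫ x, x ^ k * evenOrtho a (n + 1) x ∂μ +
          c1 * ∫ x, x ^ k * evenOrtho a n1 x ∂μ + c2 * ∫ x, x ^ k * evenOrtho a n2 x ∂μ := by
      intro n n1 n2 c1 c2 h
      rw [← integral_const_mul, ← integral_const_mul, ← integral_const_mul,
        ← integral_add ((i _ _).const_mul _) ((i _ _).const_mul _),
        ← integral_add (hint _ (by fun_prop)) ((i _ _).const_mul _)]
      congr 1
      ext x
      linear_combination x ^ k * h x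
    rw [pow_succ, mul_apply_eq_comp]
    match n with
    | 0 =>
      rw [lin 0 0 0 (1 / 4) 0 (fun x => by simp only [evenOrtho]; ring), mul_zero,
        fieldOp_sq_numberVec_zero hf, map_add, map_smul, inner_add_right, inner_smul_right]
      simp only [Complex.ofReal_add, Complex.ofReal_mul, ih, mul_zero]
      generalize inner ℂ (vacuum q H) (((fieldOp f ^ 2) ^ k) (numberVec q f 0)) = A
      generalize inner ℂ (vacuum q H) _ = B
      push_cast
      ring
    | 1 =>
      rw [lin 1 1 0 ((1 + a) / 4) (a / 4) (fun x => by simp only [evenOrtho]; ring), mul_one,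
        fieldOp_sq_numberVec_two hf]
      simp only [map_add, map_smul, inner_add_right, inner_smul_right]
      simp only [Complex.ofReal_add, Complex.ofReal_mul, ih, mul_zero, mul_one, hq]
      generalize inner ℂ (vacuum q H) _ = A
      generalize inner ℂ (vacuum q H) _ = B
      generalize inner ℂ (vacuum q H) _ = C
      push_cast
      ring
    | n + 2 =>
      rw [lin (n + 2) (n + 2) (n + 1) (1 / 2) (1 / 4) (fun x => by simp only [evenOrtho]; ring),
        show 2 * (n + 2) = 2 * n + 4 by ring, fieldOp_sq_numberVec_add_four hf]
      simp only [map_add, map_smul, inner_add_right, inner_smul_right]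
      simp only [Complex.ofReal_add, Complex.ofReal_mul]
      rw [ih, ih, ih, show 2 * (n + 2 + 1) = 2 * n + 6 by ring,
        show 2 * (n + 2) = 2 * n + 4 by ring, show 2 * (n + 1) = 2 * n + 2 by ring]
      generalize inner ℂ (vacuum q H) _ = A
      generalize inner ℂ (vacuum q H) _ = B
      generalize inner ℂ (vacuum q H) _ = C
      push_cast
      ring

lemma isVacuumDistribution_of_integrals {H : Type u} [NormedAddCommGroup H]
    [InnerProductSpace ℂ H] {q : Set.Icc (-1 : ℝ) 1} {a : ℝ} (hq : (q : ℝ) = a - 1) {f : H}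
    (hf : ‖f‖ = 1 / 2) {μ : Measure ℝ} [IsFiniteMeasure μ]
    (hsupp : ∃ R : ℝ, μ (Set.Icc (-R) R)ᶜ = 0)
    (h0 : ∫ _, (1 : ℝ) ∂μ = 1) (h1 : a ≠ 1 → ∫ x, x ∂μ = 1 / 4)
    (hD0 : ∫ x, denom a x ∂μ = a)
    (hD : ∀ n, ∫ x, denom a x * evenChebyshev (n + 1) x ∂μ = 0) :
    IsVacuumDistribution (fieldOp (q := q) f ^ 2) μ := by
  -- A finite measure carried by a compact interval integrates every continuous function.
  have hint : ∀ g : ℝ → ℝ, Continuous g → Integrable g μ := by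
    intro g hg
    obtain ⟨R, hR⟩ := hsupp
    have hr : μ.restrict (Set.Icc (-R) R) = μ :=
      Measure.restrict_eq_self_of_ae_mem (by rwa [ae_iff])
    rw [← hr]
    exact hg.continuousOn.integrableOn_compact isCompact_Icc
  refine ⟨⟨?_⟩, hsupp, fun k => ?_⟩
  · simp only [integral_const, smul_eq_mul, mul_one, measureReal_def] at h0
    rw [← ENNReal.toReal_eq_one_iff, h0]
  · have h := integral_pow_mul_evenOrtho hq hf hint h0
      (integral_evenOrtho_eq_zero hint h0 h1 hD0 hD) k 0
    simpa [evenOrtho, numberVec_zero] using h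

/-! ## Integrals of rational functions -/

section

open MeasureTheory Set Filter Topology Real

/-- An antiderivative is `u⁻¹ arctan ((t - s/t)/u)`, because `(t - s/t)' = (t² + s)/t²`; it rises
from `-π/(2u)` to `π/(2u)`. -/
lemma integrableOn_integral_arctan_sub_div {s u : ℝ} (hs : 0 < s) (hu : 0 < u) :
    IntegrableOn (fun t => (t ^ 2 + s) / ((t ^ 2 - s) ^ 2 + u ^ 2 * t ^ 2)) (Ioi 0) ∧
      ∫ t in Ioi 0, (t ^ 2 + s) / ((t ^ 2 - s) ^ 2 + u ^ 2 * t ^ 2) = π / u := by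
  -- Division by zero gives a wrong value at `0`; it is replaced by the right-hand limit.
  set F : ℝ → ℝ := Function.update (fun t => u⁻¹ * arctan ((t - s / t) / u)) 0 (u⁻¹ * -(π / 2))
    with hF
  have hF0 : ∀ t, 0 < t → F t = u⁻¹ * arctan ((t - s / t) / u) := fun t ht =>
    Function.update_of_ne ht.ne' _ _
  have hderiv : ∀ t ∈ Ioi (0 : ℝ),
      HasDerivAt F ((t ^ 2 + s) / ((t ^ 2 - s) ^ 2 + u ^ 2 * t ^ 2)) t := by
    intro t (ht : 0 < t)
    have h1 : HasDerivAt (fun t : ℝ => (t - s / t) / u) ((1 - s * (-(t ^ 2)⁻¹)) / u) t := by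
      simp only [div_eq_mul_inv]
      exact ((hasDerivAt_id' t).fun_sub ((hasDerivAt_inv ht.ne').const_mul s)).mul_const u⁻¹
    have h2 := (h1.arctan).const_mul u⁻¹
    refine (h2.congr_of_eventuallyEq ?_).congr_deriv ?_
    · filter_upwards [lt_mem_nhds ht] with x hx
      exact hF0 x hx
    · have : 0 < (t ^ 2 - s) ^ 2 + u ^ 2 * t ^ 2 := by positivity
      have h3 : 1 + ((t - s / t) / u) ^ 2 =
          ((t ^ 2 - s) ^ 2 + u ^ 2 * t ^ 2) / (u ^ 2 * t ^ 2) := by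
        field_simp; ring
      rw [h3]
      field_simp
      ring
  have hcont : ContinuousWithinAt F (Ici 0) 0 := by
    rw [continuousWithinAt_update_same]
    have hset : Ici (0 : ℝ) \ {0} = Ioi 0 := by
      ext t; simp [lt_iff_le_and_ne, eq_comm]
    rw [hset]
    refine Tendsto.const_mul _ ((tendsto_nhds_of_tendsto_nhdsWithin tendsto_arctan_atBot).comp ?_)
    refine Tendsto.atBot_div_const hu ?_
    have h1 : Tendsto (fun t : ℝ => s / t) (𝓝[>] 0) atTop := by
      simpa only [div_eq_mul_inv] using tendsto_inv_nhdsGT_zero.const_mul_atTop hs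
    have h2 : Tendsto (fun t : ℝ => t) (𝓝[>] 0) (𝓝 0) := nhdsWithin_le_nhds
    simp only [sub_eq_add_neg]
    exact h2.add_atBot (tendsto_neg_atTop_atBot.comp h1)
  have hlim : Tendsto F atTop (𝓝 (u⁻¹ * (π / 2))) := by
    have h0 : Tendsto (fun t : ℝ => u⁻¹ * arctan ((t - s / t) / u)) atTop
        (𝓝 (u⁻¹ * (π / 2))) := by
      refine Tendsto.const_mul _
        ((tendsto_nhds_of_tendsto_nhdsWithin tendsto_arctan_atTop).comp ?_)
      refine Tendsto.atTop_div_const hu ?_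
      have h1 : Tendsto (fun t : ℝ => -(s / t)) atTop (𝓝 (-0)) :=
        (tendsto_const_nhds.div_atTop tendsto_id).neg
      simp only [sub_eq_add_neg]
      exact tendsto_id.atTop_add h1
    refine h0.congr' ?_
    filter_upwards [eventually_gt_atTop 0] with t ht
    exact (hF0 t ht).symm
  have hpos : ∀ t ∈ Ioi (0 : ℝ), 0 ≤ (t ^ 2 + s) / ((t ^ 2 - s) ^ 2 + u ^ 2 * t ^ 2) :=
    fun t _ => by positivity
  refine ⟨integrableOn_Ioi_deriv_of_nonneg hcont hderiv hpos hlim, ?_⟩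
  rw [integral_Ioi_of_hasDerivAt_of_nonneg hcont hderiv hpos hlim]
  simp only [F, Function.update_self]
  field_simp
  ring

/-- The involution `t ↦ s/t` of the half-line exchanges the two integrands. -/
lemma integral_inversion_biquadratic {s u : ℝ} (hs : 0 < s) (hu : 0 < u) :
    ∫ t in Ioi 0, t ^ 2 / ((t ^ 2 - s) ^ 2 + u ^ 2 * t ^ 2) =
      ∫ t in Ioi 0, s / ((t ^ 2 - s) ^ 2 + u ^ 2 * t ^ 2) := by
  have himg : (fun t : ℝ => s / t) '' Ioi 0 = Ioi 0 := by
    ext x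
    constructor
    · rintro ⟨t, ht, rfl⟩
      exact div_pos hs ht
    · intro hx
      exact ⟨s / x, div_pos hs hx, div_div_cancel₀ hs.ne'⟩
  have h := integral_image_eq_integral_abs_deriv_smul (s := Ioi (0 : ℝ)) (f := fun t => s / t)
    (f' := fun t => -(s / t ^ 2)) measurableSet_Ioi
    (fun t (ht : 0 < t) => by
      have := (hasDerivAt_inv ht.ne').const_mul s
      simp only [div_eq_mul_inv]
      exact (this.congr_deriv (by ring)).hasDerivWithinAt)
    (fun x (hx : 0 < x) y (hy : 0 < y) hxy => by
      simp only at hxy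
      rw [div_eq_div_iff hx.ne' hy.ne'] at hxy
      exact (mul_left_cancel₀ hs.ne' hxy).symm)
    (fun t => t ^ 2 / ((t ^ 2 - s) ^ 2 + u ^ 2 * t ^ 2))
  rw [himg] at h
  rw [h]
  refine setIntegral_congr_fun measurableSet_Ioi fun t (ht : 0 < t) => ?_
  have : 0 < (t ^ 2 - s) ^ 2 + u ^ 2 * t ^ 2 := by positivity
  have h1 : ((s / t) ^ 2 - s) ^ 2 + u ^ 2 * (s / t) ^ 2 =
      s ^ 2 / t ^ 4 * ((t ^ 2 - s) ^ 2 + u ^ 2 * t ^ 2) := by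
    field_simp; ring
  simp only [abs_neg, smul_eq_mul]
  rw [abs_of_pos (by positivity), h1]
  field_simp

/-- By the inversion symmetry each of `t²` and `s` contributes half of the arctangent integral. The
case `s = 0`, which occurs at `a = 3/2`, has no such inversion and reduces to `1/(t² + u²)`. -/
lemma integrableOn_integral_biquadratic {s u : ℝ} (hs : 0 ≤ s) (hu : 0 < u) :
    IntegrableOn (fun t => t ^ 2 / ((t ^ 2 - s) ^ 2 + u ^ 2 * t ^ 2)) (Ioi 0) ∧
    IntegrableOn (fun t => s ^ 2 / ((t ^ 2 - s) ^ 2 + u ^ 2 * t ^ 2)) (Ioi 0) ∧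
    ∫ t in Ioi 0, t ^ 2 / ((t ^ 2 - s) ^ 2 + u ^ 2 * t ^ 2) = π / (2 * u) ∧
    ∫ t in Ioi 0, s ^ 2 / ((t ^ 2 - s) ^ 2 + u ^ 2 * t ^ 2) = π * s / (2 * u) := by
  rcases hs.eq_or_lt with rfl | hs
  · have e : EqOn (fun t : ℝ => t ^ 2 / ((t ^ 2 - 0) ^ 2 + u ^ 2 * t ^ 2))
        (fun t => (u ^ 2)⁻¹ * (1 + (u⁻¹ * t) ^ 2)⁻¹) (Ioi 0) := by
      intro t (ht : 0 < t)
      simp only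
      have h1 : 0 < t ^ 2 + u ^ 2 := by positivity
      have h2 : 1 + (u⁻¹ * t) ^ 2 = (t ^ 2 + u ^ 2) / u ^ 2 := by field_simp; ring
      have h3 : (t ^ 2 - 0) ^ 2 + u ^ 2 * t ^ 2 = t ^ 2 * (t ^ 2 + u ^ 2) := by ring
      rw [h2, h3]
      field_simp
    have hi : IntegrableOn (fun t => (1 + (u⁻¹ * t) ^ 2)⁻¹) (Ioi 0) :=
      (integrableOn_Ioi_comp_mul_left_iff (fun t : ℝ => (1 + t ^ 2)⁻¹) 0 (inv_pos.2 hu)).2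
        integrable_inv_one_add_sq.integrableOn
    refine ⟨(integrableOn_congr_fun e measurableSet_Ioi).2 (hi.const_mul _), by simp, ?_, by simp⟩
    rw [setIntegral_congr_fun measurableSet_Ioi e, integral_const_mul,
      integral_comp_mul_left_Ioi (fun t : ℝ => (1 + t ^ 2)⁻¹) 0 (inv_pos.2 hu), mul_zero,
      integral_Ioi_inv_one_add_sq, arctan_zero]
    simp only [inv_inv, smul_eq_mul, sub_zero]
    field_simp
  · obtain ⟨hi, hv⟩ := integrableOn_integral_arctan_sub_div hs hu
    have hm : ∀ g : ℝ → ℝ, Measurable g →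
        (∀ t, |g t| ≤ t ^ 2 + s) →
        IntegrableOn (fun t => g t / ((t ^ 2 - s) ^ 2 + u ^ 2 * t ^ 2)) (Ioi 0) := by
      intro g hg hb
      refine Integrable.mono' hi (Measurable.aestronglyMeasurable (by fun_prop))
        (Eventually.of_forall fun t => ?_)
      rw [norm_div, norm_eq_abs, norm_of_nonneg (by positivity)]
      exact div_le_div_of_nonneg_right (hb t) (by positivity)
    have i1 := hm (fun t => t ^ 2) (by fun_prop)
      (fun t => by rw [abs_of_nonneg (by positivity)]; linarith)
    have i2 := hm (fun _ => s) (by fun_prop)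
      (fun t => by rw [abs_of_pos hs]; linarith [sq_nonneg t])
    have hadd : (∫ t in Ioi 0, t ^ 2 / ((t ^ 2 - s) ^ 2 + u ^ 2 * t ^ 2)) +
        (∫ t in Ioi 0, s / ((t ^ 2 - s) ^ 2 + u ^ 2 * t ^ 2)) = π / u := by
      rw [← hv, ← integral_add i1 i2]
      simp only [add_div]
    have hsym := integral_inversion_biquadratic hs hu
    have e2 : (fun t : ℝ => s ^ 2 / ((t ^ 2 - s) ^ 2 + u ^ 2 * t ^ 2)) =
        fun t => s * (s / ((t ^ 2 - s) ^ 2 + u ^ 2 * t ^ 2)) := by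
      ext t; ring
    have hval : ∫ t in Ioi 0, t ^ 2 / ((t ^ 2 - s) ^ 2 + u ^ 2 * t ^ 2) = π / (2 * u) := by
      have : π / (2 * u) = (π / u) / 2 := by field_simp
      linarith
    refine ⟨i1, ?_, hval, ?_⟩
    · rw [e2]; exact i2.const_mul s
    · rw [e2, integral_const_mul, ← hsym, hval]
      ring

/-! ## The moments of the density -/

lemma denom_eq_add_sq (a x : ℝ) :
    denom a x = (1 - (4 - 2 * a) * x) ^ 2 + 4 * a ^ 2 * (x * (1 - x)) := by
  simp only [denom]; ring

lemma denom_pos {a x : ℝ} (ha : 0 < a) (hx : x ∈ Ioo (0 : ℝ) 1) : 0 < denom a x := by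
  rw [denom_eq_add_sq]
  have : 0 < x * (1 - x) := mul_pos hx.1 (sub_pos.2 hx.2)
  positivity

lemma pDensity_of_mem {a x : ℝ} (hx : x ∈ Ioo (0 : ℝ) 1) :
    pDensity a x = 2 * a / π * (√(1 - x) / (√x * denom a x)) := by
  rw [pDensity, indicator_of_mem hx, denom]

lemma pDensity_of_notMem {a x : ℝ} (hx : x ∉ Ioo (0 : ℝ) 1) : pDensity a x = 0 :=
  indicator_of_notMem hx _

lemma pDensity_pos {a : ℝ} (ha : 0 < a) {x : ℝ} (hx : x ∈ Ioo (0 : ℝ) 1) : 0 < pDensity a x := by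
  rw [pDensity_of_mem hx]
  have h1 := denom_pos ha hx
  have h2 := sqrt_pos.2 (sub_pos.2 hx.2)
  have h3 := sqrt_pos.2 hx.1
  have := pi_pos
  positivity

lemma pDensity_nonneg {a : ℝ} (ha : 0 < a) (x : ℝ) : 0 ≤ pDensity a x := by
  by_cases hx : x ∈ Ioo (0 : ℝ) 1
  · exact (pDensity_pos ha hx).le
  · rw [pDensity_of_notMem hx]

lemma measurable_pDensity (a : ℝ) : Measurable (pDensity a) := by
  unfold pDensity
  exact Measurable.indicator (by fun_prop) measurableSet_Ioo

lemma image_inv_one_add_sq : (fun t : ℝ => (1 + t ^ 2)⁻¹) '' Ioi 0 = Ioo 0 1 := by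
  ext x
  constructor
  · rintro ⟨t, ht, rfl⟩
    have ht : 0 < t := ht
    exact ⟨by positivity, inv_lt_one_of_one_lt₀ (by nlinarith [sq_pos_of_pos ht])⟩
  · rintro ⟨h0, h1⟩
    have : 0 < x⁻¹ - 1 := sub_pos.2 ((one_lt_inv₀ h0).2 h1)
    refine ⟨√(x⁻¹ - 1), sqrt_pos.2 this, ?_⟩
    simp only
    rw [sq_sqrt this.le, add_sub_cancel, inv_inv]

lemma substitution_inv_one_add_sq (g : ℝ → ℝ) :
    (IntegrableOn g (Ioo 0 1) ↔
      IntegrableOn (fun t => 2 * t / (1 + t ^ 2) ^ 2 * g (1 + t ^ 2)⁻¹) (Ioi 0)) ∧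
    ∫ x in Ioo 0 1, g x = ∫ t in Ioi 0, 2 * t / (1 + t ^ 2) ^ 2 * g (1 + t ^ 2)⁻¹ := by
  have hd : ∀ t ∈ Ioi (0 : ℝ), HasDerivWithinAt (fun t : ℝ => (1 + t ^ 2)⁻¹)
      (-(2 * t / (1 + t ^ 2) ^ 2)) (Ioi 0) t := by
    intro t _
    have h1 : HasDerivAt (fun t : ℝ => 1 + t ^ 2) (2 * t) t := by
      simpa using (hasDerivAt_pow 2 t).const_add 1
    have h2 := h1.inv (by positivity)
    exact (h2.congr_deriv (by ring)).hasDerivWithinAt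
  have hinj : InjOn (fun t : ℝ => (1 + t ^ 2)⁻¹) (Ioi 0) := by
    intro x (hx : 0 < x) y (hy : 0 < y) hxy
    have h1 : 1 + x ^ 2 = 1 + y ^ 2 := inv_injective hxy
    exact (pow_left_inj₀ hx.le hy.le two_ne_zero).1 (add_left_cancel h1)
  have habs : EqOn (fun t : ℝ => |(-(2 * t / (1 + t ^ 2) ^ 2))| • g (1 + t ^ 2)⁻¹)
      (fun t => 2 * t / (1 + t ^ 2) ^ 2 * g (1 + t ^ 2)⁻¹) (Ioi 0) := by
    intro t (ht : 0 < t)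
    simp only [smul_eq_mul]
    rw [abs_neg, abs_of_pos (by positivity)]
  rw [← image_inv_one_add_sq]
  constructor
  · rw [integrableOn_image_iff_integrableOn_abs_deriv_smul measurableSet_Ioi hd hinj g,
      integrableOn_congr_fun habs measurableSet_Ioi]
  · rw [integral_image_eq_integral_abs_deriv_smul measurableSet_Ioi hd hinj g,
      setIntegral_congr_fun measurableSet_Ioi habs]

/-- With `x = 1/(1 + t²)`, `√(1-x)/√x` becomes `t`, and the conditions on `s` and `u` say exactly
that `(1 + t²)² denom a x = (t² - s)² + u² t²`. -/
lemma jacobian_mul_pDensity {a s u : ℝ} (hu : 0 < u) (hs2 : s ^ 2 = (3 - 2 * a) ^ 2)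
    (hu2 : u ^ 2 = 4 * a ^ 2 + 4 * a - 6 + 2 * s) {t : ℝ} (ht : 0 < t) :
    2 * t / (1 + t ^ 2) ^ 2 * pDensity a (1 + t ^ 2)⁻¹ =
      4 * a / π * (t ^ 2 / ((t ^ 2 - s) ^ 2 + u ^ 2 * t ^ 2)) := by
  have hmem : (1 + t ^ 2)⁻¹ ∈ Ioo (0 : ℝ) 1 := image_inv_one_add_sq ▸ mem_image_of_mem _ ht
  have hq : 0 < (t ^ 2 - s) ^ 2 + u ^ 2 * t ^ 2 := by positivity
  have hD : denom a (1 + t ^ 2)⁻¹ = ((t ^ 2 - s) ^ 2 + u ^ 2 * t ^ 2) / (1 + t ^ 2) ^ 2 := by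
    rw [eq_div_iff (by positivity), denom]
    field_simp
    linear_combination (-t ^ 2) * hu2 - hs2
  have hsq : √(1 - (1 + t ^ 2)⁻¹) = t * √(1 + t ^ 2)⁻¹ := by
    rw [show 1 - (1 + t ^ 2)⁻¹ = t ^ 2 * (1 + t ^ 2)⁻¹ by field_simp; ring,
      sqrt_mul (by positivity), sqrt_sq ht.le]
  have hs0 : 0 < √(1 + t ^ 2)⁻¹ := sqrt_pos.2 hmem.1
  rw [pDensity_of_mem hmem, hD, hsq]
  generalize √(1 + t ^ 2)⁻¹ = r at hs0
  have := pi_pos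
  field_simp
  ring

lemma integrable_and_integral_pDensity {a s u : ℝ} (hs : 0 ≤ s) (hu : 0 < u)
    (hs2 : s ^ 2 = (3 - 2 * a) ^ 2) (hu2 : u ^ 2 = 4 * a ^ 2 + 4 * a - 6 + 2 * s) :
    Integrable (pDensity a) ∧ ∫ x, pDensity a x = 2 * a / u ∧
      (a ≠ 1 → ∫ x, x * pDensity a x = a / (8 * (a - 1)) * (1 - (1 + s) / u)) := by
  obtain ⟨i1, i2, v1, v2⟩ := integrableOn_integral_biquadratic hs hu
  have hsupp : ∀ g : ℝ → ℝ, ∫ x, g x * pDensity a x = ∫ x in Ioo 0 1, g x * pDensity a x := by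
    intro g
    rw [setIntegral_eq_integral_of_forall_compl_eq_zero]
    intro x hx
    rw [pDensity_of_notMem hx, mul_zero]
  have hpi := pi_pos
  refine ⟨?_, ?_, fun ha => ?_⟩
  · have h : IntegrableOn (pDensity a) (Ioo 0 1) := by
      rw [(substitution_inv_one_add_sq _).1]
      refine (integrableOn_congr_fun (fun t ht => ?_) measurableSet_Ioi).2
        (i1.const_mul (4 * a / π))
      exact jacobian_mul_pDensity hu hs2 hu2 ht
    refine h.integrable_of_forall_notMem_eq_zero fun x hx => pDensity_of_notMem hx
  · have h := hsupp fun _ => 1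
    simp only [one_mul] at h
    rw [h, (substitution_inv_one_add_sq _).2,
      setIntegral_congr_fun measurableSet_Ioi fun t ht => jacobian_mul_pDensity hu hs2 hu2 ht,
      integral_const_mul, v1]
    field_simp
    ring
  · have ha' : a - 1 ≠ 0 := sub_ne_zero.2 ha
    have e : EqOn (fun t : ℝ => 2 * t / (1 + t ^ 2) ^ 2 * ((1 + t ^ 2)⁻¹ *
        pDensity a (1 + t ^ 2)⁻¹)) (fun t => a / (4 * π * (a - 1)) * ((1 + t ^ 2)⁻¹ -
          (t ^ 2 / ((t ^ 2 - s) ^ 2 + u ^ 2 * t ^ 2) +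
            s ^ 2 / ((t ^ 2 - s) ^ 2 + u ^ 2 * t ^ 2)))) (Ioi 0) := by
      intro t (ht : 0 < t)
      have h := jacobian_mul_pDensity hu hs2 hu2 ht
      simp only
      have hq : 0 < (t ^ 2 - s) ^ 2 + u ^ 2 * t ^ 2 := by positivity
      -- This is the partial fraction identity behind the mean; its factor `a - 1` is why `a ≠ 1` is
      -- required.
      have key : (t ^ 2 - s) ^ 2 + u ^ 2 * t ^ 2 - (t ^ 2 + s ^ 2) * (1 + t ^ 2) =
          16 * (a - 1) * t ^ 2 := by
        linear_combination t ^ 2 * hu2 - t ^ 2 * hs2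
      calc _ = (1 + t ^ 2)⁻¹ * (4 * a / π * (t ^ 2 / ((t ^ 2 - s) ^ 2 + u ^ 2 * t ^ 2))) := by
            rw [← h]; ring
        _ = a / (4 * π * (a - 1)) * (((t ^ 2 - s) ^ 2 + u ^ 2 * t ^ 2 -
              (t ^ 2 + s ^ 2) * (1 + t ^ 2)) /
              ((1 + t ^ 2) * ((t ^ 2 - s) ^ 2 + u ^ 2 * t ^ 2))) := by
            rw [key]
            generalize (t ^ 2 - s) ^ 2 + u ^ 2 * t ^ 2 = Q at hq
            field_simp
            ring
        _ = _ := by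
            generalize (t ^ 2 - s) ^ 2 + u ^ 2 * t ^ 2 = Q at hq
            field_simp
    have i3 : IntegrableOn (fun t : ℝ => (1 + t ^ 2)⁻¹) (Ioi 0) :=
      integrable_inv_one_add_sq.integrableOn
    have i4 : IntegrableOn (fun t => t ^ 2 / ((t ^ 2 - s) ^ 2 + u ^ 2 * t ^ 2) +
        s ^ 2 / ((t ^ 2 - s) ^ 2 + u ^ 2 * t ^ 2)) (Ioi 0) := i1.add i2
    rw [hsupp fun x => x, (substitution_inv_one_add_sq _).2,
      setIntegral_congr_fun measurableSet_Ioi e, integral_const_mul, integral_sub i3 i4,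
      integral_add i1 i2, v1, v2,
      integral_Ioi_inv_one_add_sq, arctan_zero]
    field_simp
    ring

/-! ### Chebyshev orthogonality with respect to `pDensity 1` -/

lemma sin_evenChebyshev (n : ℕ) (θ : ℝ) :
    evenChebyshev n (cos θ ^ 2) * sin θ = sin ((2 * n + 1) * θ) := by
  induction n using Nat.twoStepInduction with
  | zero => simp [evenChebyshev]
  | one =>
    simp only [evenChebyshev, Nat.cast_one]
    rw [show (2 * 1 + 1) * θ = 3 * θ by ring, sin_three_mul]
    linear_combination 4 * sin θ * (sin_sq_add_cos_sq θ)
  | more n h1 h2 =>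
    simp only [evenChebyshev]
    push_cast at *
    have e1 : (2 * ((n : ℝ) + 2) + 1) * θ = (2 * (n + 1) + 1) * θ + 2 * θ := by ring
    have e2 : (2 * (n : ℝ) + 1) * θ = (2 * (n + 1) + 1) * θ - 2 * θ := by ring
    rw [e2, sin_sub] at h1
    rw [e1, sin_add]
    rw [cos_two_mul] at *
    linear_combination (4 * cos θ ^ 2 - 2) * h2 - h1

lemma integrable_and_integral_pDensity_one :
    Integrable (pDensity 1) ∧ ∫ x, pDensity 1 x = 1 := by
  obtain ⟨h1, h2, -⟩ := integrable_and_integral_pDensity (a := 1) (s := 1) (u := 2) (by norm_num)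
    (by norm_num) (by norm_num) (by norm_num)
  exact ⟨h1, by rw [h2]; norm_num⟩

lemma denom_mul_pDensity {a : ℝ} (ha : 0 < a) (x : ℝ) :
    denom a x * pDensity a x = a * pDensity 1 x := by
  by_cases hx : x ∈ Ioo (0 : ℝ) 1
  · rw [pDensity_of_mem hx, pDensity_of_mem hx]
    have h1 := denom_pos ha hx
    have h2 : denom 1 x = 1 := by simp [denom]
    have h3 := sqrt_pos.2 hx.1
    have := pi_pos
    rw [h2]
    field_simp
  · simp [pDensity_of_notMem hx]

lemma integrable_mul_pDensity {a : ℝ} (hp : Integrable (pDensity a)) {g : ℝ → ℝ}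
    (hg : Continuous g) : Integrable (fun x => g x * pDensity a x) := by
  obtain ⟨C, hC⟩ := isCompact_Icc.exists_bound_of_continuousOn (s := Icc (0 : ℝ) 1)
    hg.continuousOn
  refine (hp.norm.const_mul C).mono' (hg.measurable.mul (measurable_pDensity a)).aestronglyMeasurable
    (Eventually.of_forall fun x => ?_)
  by_cases hx : x ∈ Ioo (0 : ℝ) 1
  · rw [norm_mul]
    exact mul_le_mul_of_nonneg_right (hC x (Ioo_subset_Icc_self hx)) (norm_nonneg _)
  · simp [pDensity_of_notMem hx]

lemma integral_evenChebyshev_mul_pDensity_one (n : ℕ) :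
    ∫ x, evenChebyshev (n + 1) x * pDensity 1 x = 0 := by
  set m : ℝ := 2 * (n + 1) with hm
  have hm0 : 0 < m := by positivity
  have hi := integrable_mul_pDensity integrable_and_integral_pDensity_one.1
    (continuous_evenChebyshev (n + 1))
  -- With `x = cos² θ` one has `p₁(x) dx = -(4/π) sin² θ dθ`, so the integrand is `-(4/π) sin
  -- ((m+1)θ) sin θ = (2/π)(cos ((m+2)θ) - cos (mθ))`.
  set F : ℝ → ℝ := fun x => 2 / π * (sin ((m + 2) * arccos (√x)) / (m + 2) -
    sin (m * arccos (√x)) / m) with hF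
  have hcont : Continuous F := by
    have := continuous_arccos.comp continuous_sqrt
    have h1 : Continuous fun x => arccos (√x) := this
    fun_prop
  have hderiv : ∀ x ∈ Ioo (0 : ℝ) 1,
      HasDerivAt F (evenChebyshev (n + 1) x * pDensity 1 x) x := by
    intro x hx
    have hr0 : 0 < √x := sqrt_pos.2 hx.1
    have hr1 : √x < 1 := by rw [sqrt_lt' one_pos]; simpa using hx.2
    have hw : 0 < √(1 - x) := sqrt_pos.2 (sub_pos.2 hx.2)
    have hθ : HasDerivAt (fun x => arccos (√x)) (-(1 / √(1 - √x ^ 2)) * (1 / (2 * √x))) x :=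
      (hasDerivAt_arccos (by linarith) hr1.ne).comp x (hasDerivAt_sqrt hx.1.ne')
    rw [sq_sqrt hx.1.le] at hθ
    have hs : ∀ c : ℝ, 0 < c → HasDerivAt (fun x => sin (c * arccos (√x)) / c)
        (cos (c * arccos (√x)) * (-(1 / √(1 - x)) * (1 / (2 * √x)))) x := fun c hc =>
      ((hθ.const_mul c).sin.div_const c).congr_deriv (by field_simp)
    refine (((hs (m + 2) (by positivity)).fun_sub (hs m hm0)).const_mul (2 / π)).congr_deriv ?_
    have hcos : cos (arccos (√x)) = √x := cos_arccos (by linarith) hr1.le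
    have hsin : sin (arccos (√x)) = √(1 - x) := by rw [sin_arccos, sq_sqrt hx.1.le]
    have hU := sin_evenChebyshev (n + 1) (arccos (√x))
    rw [hcos, sq_sqrt hx.1.le, hsin] at hU
    set θ := arccos (√x)
    have e1 : (m + 2) * θ = (m + 1) * θ + θ := by ring
    have e2 : m * θ = (m + 1) * θ - θ := by ring
    have e3 : (2 * ((n + 1 : ℕ) : ℝ) + 1) * θ = (m + 1) * θ := by push_cast; rfl
    rw [e3] at hU
    rw [e1, e2, cos_add, cos_sub, hsin, pDensity_of_mem hx, ← hU]
    have h2 : denom 1 x = 1 := by simp [denom]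
    have := pi_pos
    rw [h2]
    field_simp
    ring
  have hsupp : ∫ x, evenChebyshev (n + 1) x * pDensity 1 x =
      ∫ x in Ioc 0 1, evenChebyshev (n + 1) x * pDensity 1 x := by
    rw [setIntegral_eq_integral_of_forall_compl_eq_zero]
    intro x hx
    rw [pDensity_of_notMem fun h => hx (Ioo_subset_Ioc_self h), mul_zero]
  rw [hsupp, ← intervalIntegral.integral_of_le zero_le_one,
    intervalIntegral.integral_eq_sub_of_hasDerivAt_of_le zero_le_one hcont.continuousOn hderiv
      hi.intervalIntegrable]
  -- Since `m` is even, the sines vanish at `θ = π/2` as well as at `θ = 0`.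
  have e1 : (m + 2) * (π / 2) = (n + 2 : ℕ) * π := by rw [hm]; push_cast; ring
  have e2 : m * (π / 2) = (n + 1 : ℕ) * π := by rw [hm]; push_cast; ring
  simp only [hF, sqrt_zero, sqrt_one, arccos_zero, arccos_one, e1, e2, sin_nat_mul_pi]
  simp

lemma integral_denom_mul_pDensity {a : ℝ} (ha : 0 < a) :
    ∫ x, denom a x * pDensity a x = a := by
  simp_rw [denom_mul_pDensity ha]
  rw [integral_const_mul, integrable_and_integral_pDensity_one.2, mul_one]

lemma integral_denom_mul_evenChebyshev_mul_pDensity {a : ℝ} (ha : 0 < a) (n : ℕ) :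
    ∫ x, denom a x * evenChebyshev (n + 1) x * pDensity a x = 0 := by
  have e : ∀ x, denom a x * evenChebyshev (n + 1) x * pDensity a x =
      a * (evenChebyshev (n + 1) x * pDensity 1 x) := fun x => by
    linear_combination evenChebyshev (n + 1) x * denom_mul_pDensity ha x
  simp_rw [e]
  rw [integral_const_mul, integral_evenChebyshev_mul_pDensity_one, mul_zero]

/-! ### Measures with density `p_a` and an atom -/

/-- The measure with density `p_a` together with an atom. -/
noncomputable def densityAddAtom (a m c : ℝ) : Measure ℝ :=
  (volume.withDensity fun x => ENNReal.ofReal (pDensity a x)) + ENNReal.ofReal m • Measure.dirac c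

lemma integral_withDensity_pDensity {a : ℝ} (ha : 0 < a) (g : ℝ → ℝ) :
    ∫ x, g x ∂(volume.withDensity fun x => ENNReal.ofReal (pDensity a x)) =
      ∫ x, g x * pDensity a x := by
  rw [integral_withDensity_eq_integral_toReal_smul
    (measurable_pDensity a).ennreal_ofReal (Eventually.of_forall fun _ => ENNReal.ofReal_lt_top)]
  refine integral_congr_ae (Eventually.of_forall fun x => ?_)
  simp only [smul_eq_mul]
  rw [ENNReal.toReal_ofReal (pDensity_nonneg ha x), mul_comm]

lemma integrable_withDensity_pDensity {a : ℝ} (ha : 0 < a) (hp : Integrable (pDensity a))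
    {g : ℝ → ℝ} (hg : Continuous g) :
    Integrable g (volume.withDensity fun x => ENNReal.ofReal (pDensity a x)) := by
  rw [integrable_withDensity_iff_integrable_smul'
    (measurable_pDensity a).ennreal_ofReal (Eventually.of_forall fun _ => ENNReal.ofReal_lt_top)]
  refine (integrable_mul_pDensity hp hg).congr (Eventually.of_forall fun x => ?_)
  simp only [smul_eq_mul]
  rw [ENNReal.toReal_ofReal (pDensity_nonneg ha x), mul_comm]

lemma integral_densityAddAtom {a m c : ℝ} (ha : 0 < a) (hm : 0 ≤ m) (hp : Integrable (pDensity a))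
    {g : ℝ → ℝ} (hg : Continuous g) :
    ∫ x, g x ∂(densityAddAtom a m c) = (∫ x, g x * pDensity a x) + m * g c := by
  rw [densityAddAtom, integral_add_measure (integrable_withDensity_pDensity ha hp hg)
    ((integrable_dirac (by simp)).smul_measure ENNReal.ofReal_ne_top),
    integral_withDensity_pDensity ha, integral_smul_measure, integral_dirac,
    ENNReal.toReal_ofReal hm, smul_eq_mul]

lemma isFiniteMeasure_densityAddAtom {a : ℝ} (hp : Integrable (pDensity a)) (m c : ℝ) :
    IsFiniteMeasure (densityAddAtom a m c) := by
  have h1 := isFiniteMeasure_withDensity_ofReal hp.2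
  have h2 : IsFiniteMeasure (ENNReal.ofReal m • Measure.dirac c) :=
    Measure.smul_finite _ ENNReal.ofReal_ne_top
  unfold densityAddAtom
  infer_instance

lemma densityAddAtom_compl_Icc {a c : ℝ} (m : ℝ) :
    densityAddAtom a m c (Icc (-max 1 |c|) (max 1 |c|))ᶜ = 0 := by
  have hmeas : MeasurableSet (Icc (-max 1 |c|) (max 1 |c|))ᶜ := measurableSet_Icc.compl
  have hc : c ∈ Icc (-max 1 |c|) (max 1 |c|) := abs_le.1 (le_max_right 1 |c|)
  rw [densityAddAtom, Measure.add_apply, Measure.smul_apply, Measure.dirac_apply' _ hmeas,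
    withDensity_apply _ hmeas]
  have h0 : ∀ x ∈ (Icc (-max 1 |c|) (max 1 |c|))ᶜ, ENNReal.ofReal (pDensity a x) = 0 := by
    intro x hx
    rw [pDensity_of_notMem, ENNReal.ofReal_zero]
    intro h
    exact hx ⟨by linarith [h.1, le_max_left 1 |c|], by linarith [h.2, le_max_left 1 |c|]⟩
  rw [setLIntegral_congr_fun hmeas h0]
  simp [hc]

/-- The condition `m * denom a c = 0` covers both regimes: no mass, or an atom at a zero of `denom
a`. The atom then enters only the mass and the mean. -/
lemma isVacuumDistribution_densityAddAtom {H : Type u} [NormedAddCommGroup H]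
    [InnerProductSpace ℂ H] {q : Set.Icc (-1 : ℝ) 1} {a m c : ℝ} (ha : 0 < a)
    (hq : (q : ℝ) = a - 1) {f : H} (hf : ‖f‖ = 1 / 2) (hm : 0 ≤ m)
    (hp : Integrable (pDensity a)) (hc : m * denom a c = 0)
    (h0 : (∫ x, pDensity a x) + m = 1)
    (h1 : a ≠ 1 → (∫ x, x * pDensity a x) + m * c = 1 / 4) :
    IsVacuumDistribution (fieldOp (q := q) f ^ 2) (densityAddAtom a m c) := by
  have := isFiniteMeasure_densityAddAtom hp m c
  refine isVacuumDistribution_of_integrals hq hf ⟨_, densityAddAtom_compl_Icc m⟩ ?_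
    (fun h => ?_) ?_ (fun n => ?_)
  · rw [integral_densityAddAtom ha hm hp continuous_const]
    simpa using h0
  · rw [integral_densityAddAtom ha hm hp continuous_id']
    exact h1 h
  · rw [integral_densityAddAtom ha hm hp (continuous_denom a), hc,
      integral_denom_mul_pDensity ha, add_zero]
  · rw [integral_densityAddAtom ha hm hp (by fun_prop), ← mul_assoc, hc,
      integral_denom_mul_evenChebyshev_mul_pDensity ha, zero_mul, add_zero]

/-! ## The atom -/

/-- `2 √((a + 3) (a - 1))`. -/
noncomputable def rootSum (a : ℝ) : ℝ := 2 * √((a + 3) * (a - 1))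

lemma rootSum_pos {a : ℝ} (ha : 3 / 2 < a) : 0 < rootSum a :=
  mul_pos two_pos (sqrt_pos.2 (mul_pos (by linarith) (by linarith)))

lemma rootSum_sq {a : ℝ} (ha : 3 / 2 < a) : rootSum a ^ 2 = 4 * (a + 3) * (a - 1) := by
  rw [rootSum, mul_pow, sq_sqrt (mul_nonneg (by linarith) (by linarith))]
  ring

lemma two_mul_lt_rootSum {a : ℝ} (ha : 3 / 2 < a) : 2 * a < rootSum a := by
  refine lt_of_pow_lt_pow_left₀ 2 (rootSum_pos ha).le ?_
  rw [rootSum_sq ha]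
  nlinarith

/-- The radicand factors, because `(a + 2)² (a - 1) + 4 = a² (a + 3)`. -/
lemma sqrt_discriminant {a : ℝ} (ha : 3 / 2 < a) :
    √((a + 2) ^ 2 + 4 / (a - 1)) = a * rootSum a / (2 * (a - 1)) := by
  have h1 : 0 < a - 1 := by linarith
  have hu := rootSum_pos ha
  rw [sqrt_eq_iff_mul_self_eq_of_pos (div_pos (mul_pos (by linarith) hu) (by positivity)),
    ← pow_two, div_pow, mul_pow, rootSum_sq ha]
  field_simp
  ring

lemma aOne_eq {a : ℝ} (ha : 3 / 2 < a) :
    aOne a = a * rootSum a / (16 * (a - 1)) + (a + 2) / 8 := by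
  have h1 : 0 < a - 1 := by linarith
  rw [aOne, sqrt_discriminant ha]
  field_simp
  ring

lemma aTwo_eq {a : ℝ} (ha : 3 / 2 < a) :
    aTwo a = a * rootSum a / (16 * (a - 1)) - (a + 2) / 8 := by
  have h1 : 0 < a - 1 := by linarith
  rw [aTwo, sqrt_discriminant ha]
  field_simp
  ring

lemma aOne_mul_aTwo {a : ℝ} (ha : 3 / 2 < a) : aOne a * aTwo a = 1 / (16 * (a - 1)) := by
  have h1 : 0 < a - 1 := by linarith
  rw [aOne_eq ha, aTwo_eq ha]
  have := rootSum_sq ha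
  field_simp
  linear_combination 64 * a ^ 2 * this

lemma denom_aOne {a : ℝ} (ha : 3 / 2 < a) : denom a (aOne a) = 0 := by
  have h1 : 0 < a - 1 := by linarith
  have h := aOne_mul_aTwo ha
  have h2 : aTwo a = aOne a - (a + 2) / 4 := by rw [aOne_eq ha, aTwo_eq ha]; ring
  rw [h2, eq_div_iff (by positivity)] at h
  rw [denom]
  linear_combination -h

/-- `aOne a` is a positive zero of `denom a`, which is positive on `(0, 1)` and equals `(2a - 3)² >
0` at `1`. -/
lemma aOne_gt_one {a : ℝ} (ha : 3 / 2 < a) : 1 < aOne a := by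
  have h1 : 0 < a - 1 := by linarith
  have h0 : 0 < aOne a := by
    rw [aOne_eq ha]
    have := rootSum_pos ha
    positivity
  by_contra! h
  have hD := denom_aOne ha
  rcases h.lt_or_eq with h | h
  · exact (denom_pos (by linarith) ⟨h0, h⟩).ne' hD
  · rw [h, denom_eq_add_sq] at hD
    nlinarith [mul_pos (sub_pos.2 ha) (sub_pos.2 ha)]

lemma bigAOne_div {a : ℝ} (ha : 3 / 2 < a) :
    bigAOne a / (16 * (a - 1)) = 1 - 2 * a / rootSum a := by
  have h1 : 0 < a - 1 := by linarith
  have hu := rootSum_pos ha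
  have hprod := aOne_mul_aTwo ha
  have ha1 : 0 < aOne a := by linarith [aOne_gt_one ha]
  have ha2 : 0 < aTwo a := by
    have h : 0 < aOne a * aTwo a := by rw [hprod]; positivity
    exact (pos_iff_pos_of_mul_pos h).1 ha1
  have hdiff : aOne a - aTwo a = (a + 2) / 4 := by rw [aOne_eq ha, aTwo_eq ha]; ring
  -- The zeros `-a₂` and `a₁` of `denom a` correspond under `t² = (1 - x)/x` to `-X²` and `-Y²`.
  -- Thus `(t² - s)² + u² t² = (t² + X²)(t² + Y²)`, which predicts `XY = s = 2a - 3` and `X + Y = u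
  -- = rootSum a`.
  set X := √((aTwo a + 1) / aTwo a) with hX
  set Y := √((aOne a - 1) / aOne a) with hY
  have hX0 : 0 < X := sqrt_pos.2 (by positivity)
  have hY0 : 0 < Y := sqrt_pos.2 (div_pos (by linarith [aOne_gt_one ha]) ha1)
  have hX2 : X ^ 2 = (aTwo a + 1) / aTwo a := sq_sqrt (by positivity)
  have hY2 : Y ^ 2 = (aOne a - 1) / aOne a :=
    sq_sqrt (div_nonneg (by linarith [aOne_gt_one ha]) ha1.le)
  have hpr : 16 * (a - 1) * (aOne a * aTwo a) = 1 := by rw [hprod]; field_simp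
  have hXY : X * Y = 2 * a - 3 := by
    refine (pow_left_inj₀ (mul_pos hX0 hY0).le (by linarith) two_ne_zero).1 ?_
    rw [mul_pow, hX2, hY2, div_mul_div_comm, div_eq_iff (by positivity)]
    linear_combination hdiff - hpr * ((a - 2) / 4)
  have hsum : X + Y = rootSum a := by
    refine (pow_left_inj₀ (add_pos hX0 hY0).le hu.le two_ne_zero).1 ?_
    rw [rootSum_sq ha, add_sq, hX2, hY2, mul_assoc, hXY, div_add' _ _ _ ha2.ne',
      div_add_div _ _ ha2.ne' ha1.ne', div_eq_iff (by positivity)]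
    linear_combination hdiff - hpr * ((a + 2) / 4)
  have hsub : X - Y = 16 * (a - 1) * (aOne a + aTwo a) / rootSum a := by
    rw [eq_div_iff hu.ne', ← hsum, show (X - Y) * (X + Y) = X ^ 2 - Y ^ 2 by ring, hX2, hY2,
      div_sub_div _ _ ha2.ne' ha1.ne', div_eq_iff (by positivity)]
    linear_combination -(aOne a + aTwo a) * hpr
  rw [bigAOne, ← hX, ← hY, hsub]
  have : 0 < aOne a + aTwo a := by positivity
  field_simp

end

end QTwoFock

/-! ### The two regimes of the distribution -/

theorem mainTheorem5 {H : Type u} [NormedAddCommGroup H] [InnerProductSpace ℂ H]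
    [CompleteSpace H] (a : ℝ) (ha : a ∈ Set.Ioc (0 : ℝ) 2)
    (q : Set.Icc (-1 : ℝ) 1) (hq : (q : ℝ) = a - 1) :
    ((∀ x, 0 ≤ QTwoFock.pDensity a x) ∧
      (∀ x ∈ Set.Ioo (0 : ℝ) 1, 0 < QTwoFock.pDensity a x) ∧
      Measurable (QTwoFock.pDensity a)) ∧
    (a ≤ 3 / 2 → ∀ f : H, ‖f‖ = 1 / 2 →
      QTwoFock.IsVacuumDistribution (QTwoFock.fieldOp (q := q) f ^ 2)
        (MeasureTheory.volume.withDensity fun x => ENNReal.ofReal (QTwoFock.pDensity a x))) ∧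
    (3 / 2 < a →
      (∫⁻ x, ENNReal.ofReal (QTwoFock.pDensity a x)) ≠ 1 ∧
      0 ≤ QTwoFock.bigAOne a / (16 * (a - 1)) ∧
      ∀ f : H, ‖f‖ = 1 / 2 →
        QTwoFock.IsVacuumDistribution (QTwoFock.fieldOp (q := q) f ^ 2)
          ((MeasureTheory.volume.withDensity fun x => ENNReal.ofReal (QTwoFock.pDensity a x)) +
            ENNReal.ofReal (QTwoFock.bigAOne a / (16 * (a - 1))) •
              MeasureTheory.Measure.dirac (QTwoFock.aOne a))) := by
  have ha0 : 0 < a := ha.1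
  refine ⟨⟨QTwoFock.pDensity_nonneg ha0, fun x hx => QTwoFock.pDensity_pos ha0 hx,
    QTwoFock.measurable_pDensity a⟩, fun ha1 f hf => ?_, fun ha1 => ?_⟩
  · obtain ⟨hp, h0, h1⟩ := QTwoFock.integrable_and_integral_pDensity (a := a) (s := 3 - 2 * a)
      (u := 2 * a) (by linarith) (by linarith) rfl (by ring)
    -- The atom has mass `0`, so its position `0` is arbitrary.
    have h := QTwoFock.isVacuumDistribution_densityAddAtom (c := 0) ha0 hq hf le_rfl hp
      (zero_mul _) (by rw [h0]; field_simp; simp) (fun hne => by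
        have : a - 1 ≠ 0 := sub_ne_zero.2 hne
        rw [h1 hne]
        field_simp
        ring)
    simpa [QTwoFock.densityAddAtom] using h
  · have hu := QTwoFock.rootSum_pos ha1
    have hlt := QTwoFock.two_mul_lt_rootSum ha1
    obtain ⟨hp, h0, h1⟩ := QTwoFock.integrable_and_integral_pDensity (a := a) (s := 2 * a - 3)
      (u := QTwoFock.rootSum a) (by linarith) hu (by ring)
      (by rw [QTwoFock.rootSum_sq ha1]; ring)
    have hlt1 : 2 * a / QTwoFock.rootSum a < 1 := (div_lt_one hu).2 hlt
    have hm : 0 ≤ QTwoFock.bigAOne a / (16 * (a - 1)) := by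
      rw [QTwoFock.bigAOne_div ha1]
      linarith
    refine ⟨?_, hm, fun f hf => ?_⟩
    · rw [← MeasureTheory.ofReal_integral_eq_lintegral_ofReal hp
        (Filter.Eventually.of_forall (QTwoFock.pDensity_nonneg ha0)), h0]
      intro h
      rw [ENNReal.ofReal_eq_one] at h
      exact hlt1.ne h
    · refine QTwoFock.isVacuumDistribution_densityAddAtom ha0 hq hf hm hp
        (by rw [QTwoFock.denom_aOne ha1, mul_zero]) ?_ (fun hne => ?_)
      · rw [h0, QTwoFock.bigAOne_div ha1]
        ring
      · have h2 : 0 < a - 1 := by linarith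
        have h3 := QTwoFock.rootSum_sq ha1
        rw [h1 hne, QTwoFock.bigAOne_div ha1, QTwoFock.aOne_eq ha1]
        field_simp
        linear_combination 32 * a * h3
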